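/- Let $s,t\in\{0,1\}^n$ with $n\ge 1$, and let $ed(s,t)$ be the minimum number of single-character insertions, deletions and substitutions that convert $s$ to $t$. An alignment of $s$ and $t$ keeps some characters of $s$, each matched to an equal character of $t$, and edits the rest from left to right by substitutions, deletions and insertions. Its matched pairs $(i,j)$ (with $s[i]=t[j]$) form a non-crossing matching, and it passes through $(i,j)$ if $(i,j)$ is one of them. It is optimal if it uses exactly $ed(s,t)$ operations, and greedy if, among all optimal alignments, it minimizes the sum of the indices of all matched characters of $s$ and $t$ (ties broken arbitrarily). For $r\in\{0,1\}^{6n}$, the CGK walk on $(s,t)$ driven by $r$ is the following sequence of states. Start with counters $(i_0,i_1)=(1,1)$. At each time step $j=1,\dots,3n$ the state is $(i_0,i_1)$; then $i_0$ is increased by $1$ if $i_0\le n$ and $r[(2j-1)+s[i_0]]=1$, and $i_1$ is increased by $1$ if $i_1\le n$ and $r[(2j-1)+t[i_1]]=1$. The walk passes $(u,v)\in[n]^2$ if $(u,v)$ is its state at some time step $j\le 3n$. Given $\rho$ walks, $(u,v)\in[n]^2$ is an anchor if $s[u]=t[v]$ and all $\rho$ walks pass $(u,v)$. Then there is an absolute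 constant $c_0>0$ such that for all real $c\ge c_0$, all integers $n,K\ge 1$ and all $s,t\in\{0,1\}^n$ with $ed(s,t)\le K$, the following holds for $\rho=\lceil cK^2\log_2 n\rceil$ independent CGK walks on $(s,t)$ (each driven by its own uniformly random $r\in\{0,1\}^{6n}$). 1. With probability at least $1-1/n^2$ there is an optimal alignment of $s$ and $t$ that passes through all anchors. 2. A greedy alignment exists, and every fixed greedy alignment $O$ passes through all anchors with probability at least $1-1/n^2$. -/

import Mathlib

/-- One edit operation on a binary string: the insertion, deletion or substitution of a single
character at an arbitrary position. -/
inductive EditStep : List Bool → List Bool → Prop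
  | ins (a b : List Bool) (x : Bool) : EditStep (a ++ b) (a ++ x :: b)
  | delete (a b : List Bool) (x : Bool) : EditStep (a ++ x :: b) (a ++ b)
  | subst (a b : List Bool) (x y : Bool) : EditStep (a ++ x :: b) (a ++ y :: b)

/-- `EditsIn k x y`: the string `x` can be converted to `y` by a sequence of `k` edit operations. -/
inductive EditsIn : ℕ → List Bool → List Bool → Prop
  | refl (x : List Bool) : EditsIn 0 x x
  | step {k : ℕ} {x y z : List Bool} (h : EditsIn k x y) (e : EditStep y z) : EditsIn (k + 1) x z

/-- The edit distance of two binary strings of length `n`: the minimum number of insertions,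
deletions and substitutions of single characters that convert `s` to `t`. -/
noncomputable def editDist {n : ℕ} (s t : Fin n → Bool) : ℕ :=
  sInf {k : ℕ | EditsIn k (List.ofFn s) (List.ofFn t)}

/-- `AlignsPrefix s t i j M c`: there is an alignment of the first `i` characters of `s` with the
first `j` characters of `t` which uses `c` edit operations (substitutions, deletions, insertions)
and whose set of matched pairs (kept characters, i.e. the edges of the corresponding non-crossing
matching) is exactly `M`. In each step `i` is the (zero-based) index of the next character of `s`
and `j` the index of the next character of `t`. -/
inductive AlignsPrefix {n : ℕ} (s t : Fin n → Bool) :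
    ℕ → ℕ → Finset (Fin n × Fin n) → ℕ → Prop
  | nil : AlignsPrefix s t 0 0 ∅ 0
  | keep {M : Finset (Fin n × Fin n)} {c : ℕ} (i j : Fin n) (h : AlignsPrefix s t i j M c)
      (heq : s i = t j) : AlignsPrefix s t (i + 1) (j + 1) (insert (i, j) M) c
  | subst {M : Finset (Fin n × Fin n)} {c : ℕ} (i j : Fin n) (h : AlignsPrefix s t i j M c) :
      AlignsPrefix s t (i + 1) (j + 1) M (c + 1)
  | delete {M : Finset (Fin n × Fin n)} {c j : ℕ} (i : Fin n) (h : AlignsPrefix s t i j M c) :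
      AlignsPrefix s t (i + 1) j M (c + 1)
  | ins {M : Finset (Fin n × Fin n)} {c i : ℕ} (j : Fin n) (h : AlignsPrefix s t i j M c) :
      AlignsPrefix s t i (j + 1) M (c + 1)

/-- `M` is (the set of matched pairs of) an optimal alignment of `s` and `t`: it is realized with
the minimum number `editDist s t` of edit operations. -/
def IsOptimalAlignment {n : ℕ} (s t : Fin n → Bool) (M : Finset (Fin n × Fin n)) : Prop :=
  AlignsPrefix s t n n M (editDist s t)

/-- The sum of the (one-based) indices of all matched characters of `s` and of `t`. -/
def matchedIndexSum {n : ℕ} (M : Finset (Fin n × Fin n)) : ℕ :=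
  ∑ e ∈ M, ((e.1.val + 1) + (e.2.val + 1))

/-- A greedy alignment: an optimal alignment that minimizes the sum of the indices of all matched
characters among all optimal alignments. -/
def IsGreedyAlignment {n : ℕ} (s t : Fin n → Bool) (M : Finset (Fin n × Fin n)) : Prop :=
  IsOptimalAlignment s t M ∧
    ∀ M' : Finset (Fin n × Fin n), IsOptimalAlignment s t M' →
      matchedIndexSum M ≤ matchedIndexSum M'

/-- The random bit string that drives one run of the embedding. -/
abbrev WalkBits (n : ℕ) : Type := Fin (6 * n) → Bool

/-- The counter into the string `s` at the (zero-based) time step `j` of the CGK embedding with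
random bits `r`. At each of the `3 * n` steps the embedding outputs the character `s[i]` under the
counter `i` and reads the bit of `r` at zero-based position `2 * j + s[i]` (one-based: `(2j-1)+s[i]`
at the one-based step `j`); the counter is incremented iff this bit is `1`. It stops when all
characters have been consumed (counter equal to `n`). -/
def cgkCounter {n : ℕ} (s : Fin n → Bool) (r : WalkBits n) : ℕ → ℕ
  | 0 => 0
  | j + 1 =>
    if h : cgkCounter s r j < n ∧ j < 3 * n then
      cgkCounter s r j +
        (r ⟨2 * j + (s ⟨cgkCounter s r j, h.1⟩).toNat, by
          have := Bool.toNat_le (s ⟨cgkCounter s r j, h.1⟩); omega⟩).toNat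
    else cgkCounter s r j

/-- The CGK random walk on `(s, t)` with (shared) random bits `r` passes `(u, v)`: at one of the
`3 * n` time steps its state, the pair of the two counters, is `(u, v)`. -/
def WalkPasses {n : ℕ} (s t : Fin n → Bool) (r : WalkBits n) (u v : Fin n) : Prop :=
  ∃ j < 3 * n, cgkCounter s r j = u ∧ cgkCounter t r j = v

/-- `(u, v)` is an anchor of the `ρ` walks driven by `R`: the characters at `u` and `v` agree and
all walks pass `(u, v)`. -/
def IsAnchor {n ρ : ℕ} (s t : Fin n → Bool) (R : Fin ρ → WalkBits n) (u v : Fin n) : Prop :=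
  s u = t v ∧ ∀ a : Fin ρ, WalkPasses s t (R a) u v

/-- The law of the random bits of `ρ` independent walks, each with uniformly distributed bits. -/
noncomputable def walksLaw (n ρ : ℕ) : MeasureTheory.Measure (Fin ρ → WalkBits n) :=
  MeasureTheory.Measure.pi fun _ => (PMF.uniformOfFintype (WalkBits n)).toMeasure

/-- The number of walks, `c K² log₂ n` rounded up to an integer. -/
noncomputable def numWalks (c : ℝ) (K n : ℕ) : ℕ :=
  ⌈c * (K : ℝ) ^ 2 * Real.logb 2 (n : ℝ)⌉₊

/-! A greedy alignment `O` is read as a lattice path from (0,0) to (n,n). Exchange arguments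
(`IsGreedyAlignment.not_match_of_delete` and its companions) show that the path keeps a match
whenever it stands on one, so every match outside `O` lies off the path. It then suffices that a
single walk misses each such pair (u,v) with probability at least 1/(288K²)
(`passProb_le_of_off_path`): all walks pass it with probability at most n⁻⁴, and a union bound over
at most n² pairs gives both claims.

For the single walk, consider its diagonal offset from (u,v): a match leaves it unchanged, a
mismatch moves it by +1, 0, 0, -1 with equal probability. The path serves as a barrier. The positive
part of the offset, capped at the offset of the path and scaled by a weight that grows along the
path, is a submartingale which vanishes at (u,v) and is at most V; hence the walk misses (u,v) with
probability at least the initial potential divided by V (`passProb_le_of_weights`). The weights must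
pay for the concave kink at the cap, which is felt only where the walk stands on the path at a
mismatch, that is, where the path pays for an edit.

If (u,v) is more than 3K off the main diagonal, the weight K plus running cost gives a constant
(`passProb_le_of_far`). Otherwise take the maximal diagonal run of matches ending in (u,v). The path
cannot meet it, so it passes on one side. Optimality against the detour through the run limits the
edits the weights have to pay for, and from any off-diagonal cell of the square on the run the walk
misses with probability at least 1/(64K²) (`passProb_le_beside_run`, with `passProb_transpose` for
the other side). The mismatch before the run makes the walk enter off the diagonal with constant
probability (`passProb_le_of_run`). -/

/-! ### The walk as a finite-horizon recursion -/

/-- The extension of a string by `false` to all natural indices. -/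
def extendString {n : ℕ} (s : Fin n → Bool) (i : ℕ) : Bool :=
  if h : i < n then s ⟨i, h⟩ else false

/-- The probability that the walk started in `(i, j)` visits `(u, v)` within `t` steps. -/
noncomputable def passProb (S T : ℕ → Bool) (u v : ℕ) : ℕ → ℕ → ℕ → ℝ
  | 0, i, j => if i = u ∧ j = v then 1 else 0
  | t + 1, i, j =>
    if i = u ∧ j = v then 1
    else if u < i ∨ v < j then 0
    else if S i = T j then (passProb S T u v t i j + passProb S T u v t (i + 1) (j + 1)) / 2
    else (passProb S T u v t i j + passProb S T u v t (i + 1) j + passProb S T u v t i (j + 1) +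
      passProb S T u v t (i + 1) (j + 1)) / 4

section passProb

variable {S T : ℕ → Bool} {u v : ℕ}

lemma passProb_target (t : ℕ) : passProb S T u v t u v = 1 := by
  cases t <;> simp [passProb]

lemma passProb_of_lt (t : ℕ) {i j : ℕ} (h : u < i ∨ v < j) : passProb S T u v t i j = 0 := by
  have h' : ¬ (i = u ∧ j = v) := by omega
  cases t <;> simp [passProb, h, h']

lemma passProb_succ_match (t : ℕ) {i j : ℕ} (h1 : ¬ (i = u ∧ j = v)) (h2 : ¬ (u < i ∨ v < j))
    (h3 : S i = T j) : passProb S T u v (t + 1) i j =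
      (passProb S T u v t i j + passProb S T u v t (i + 1) (j + 1)) / 2 := by
  rw [passProb, if_neg h1, if_neg h2, if_pos h3]

lemma passProb_succ_mismatch (t : ℕ) {i j : ℕ} (h1 : ¬ (i = u ∧ j = v)) (h2 : ¬ (u < i ∨ v < j))
    (h3 : S i ≠ T j) : passProb S T u v (t + 1) i j =
      (passProb S T u v t i j + passProb S T u v t (i + 1) j + passProb S T u v t i (j + 1) +
        passProb S T u v t (i + 1) (j + 1)) / 4 := by
  rw [passProb, if_neg h1, if_neg h2, if_neg h3]

lemma passProb_nonneg (t i j : ℕ) : 0 ≤ passProb S T u v t i j := by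
  induction t generalizing i j with
  | zero => unfold passProb; split_ifs <;> norm_num
  | succ t ih =>
    have := ih i j; have := ih (i + 1) j; have := ih i (j + 1); have := ih (i + 1) (j + 1)
    unfold passProb; split_ifs <;> linarith

lemma passProb_le_one (t i j : ℕ) : passProb S T u v t i j ≤ 1 := by
  induction t generalizing i j with
  | zero => unfold passProb; split_ifs <;> norm_num
  | succ t ih =>
    have := ih i j; have := ih (i + 1) j; have := ih i (j + 1); have := ih (i + 1) (j + 1)
    unfold passProb; split_ifs <;> linarith

lemma passProb_swap (t i j : ℕ) : passProb T S v u t j i = passProb S T u v t i j := by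
  induction t generalizing i j with
  | zero => simp only [passProb, and_comm]
  | succ t ih =>
    simp only [passProb, ih, and_comm, or_comm, eq_comm (a := T j)]
    split_ifs <;> ring

/-- On a square where both strings read the same word, the walk is symmetric. -/
lemma passProb_transpose {i₀ j₀ r : ℕ} (hu : u = i₀ + r) (hv : v = j₀ + r)
    (hw : ∀ k ≤ r, S (i₀ + k) = T (j₀ + k)) (t k k' : ℕ) :
    passProb S T u v t (i₀ + k) (j₀ + k') = passProb S T u v t (i₀ + k') (j₀ + k) := by
  induction t generalizing k k' with
  | zero =>
    have : (i₀ + k = u ∧ j₀ + k' = v) ↔ (i₀ + k' = u ∧ j₀ + k = v) := by omega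
    simp only [passProb, this]
  | succ t ih =>
    have e1 : (i₀ + k = u ∧ j₀ + k' = v) ↔ (i₀ + k' = u ∧ j₀ + k = v) := by omega
    have e2 : (u < i₀ + k ∨ v < j₀ + k') ↔ (u < i₀ + k' ∨ v < j₀ + k) := by omega
    by_cases h1 : i₀ + k' = u ∧ j₀ + k = v
    · simp only [passProb, e1, h1]
      simp
    by_cases h2 : u < i₀ + k' ∨ v < j₀ + k
    · rw [passProb_of_lt _ h2, passProb_of_lt _ (e2.2 h2)]
    have hk := hw k (by omega)
    have hk' := hw k' (by omega)
    have e3 : S (i₀ + k) = T (j₀ + k') ↔ S (i₀ + k') = T (j₀ + k) := by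
      rw [hk, hk', eq_comm]
    have a1 := ih k k'
    have a2 := ih (k + 1) k'
    have a3 := ih k (k' + 1)
    have a4 := ih (k + 1) (k' + 1)
    simp only [← add_assoc] at a1 a2 a3 a4
    by_cases h3 : S (i₀ + k') = T (j₀ + k)
    · rw [passProb_succ_match t h1 h2 h3, passProb_succ_match t (by rwa [e1]) (by rwa [e2])
        (e3.2 h3), a1, a4]
    · rw [passProb_succ_mismatch t h1 h2 h3, passProb_succ_mismatch t (by rwa [e1]) (by rwa [e2])
        (by rwa [ne_eq, e3]), a1, a2, a3, a4]
      ring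

end passProb

/-! ### Comparison of the CGK walk with the recursion -/

lemma cgkCounter_congr {n : ℕ} (s : Fin n → Bool) {r r' : WalkBits n} (j : ℕ)
    (h : ∀ k : Fin (6 * n), k.val < 2 * j → r k = r' k) :
    cgkCounter s r j = cgkCounter s r' j := by
  induction j with
  | zero => rfl
  | succ j ih =>
    have e := ih fun k hk => h k (by omega)
    simp only [cgkCounter, e]
    split_ifs with h1
    · congr 2
      apply h
      have := Bool.toNat_le (s ⟨cgkCounter s r' j, h1.1⟩)
      simp only
      omega
    · rfl

lemma cgkCounter_succ_of_lt {n : ℕ} (s : Fin n → Bool) (r : WalkBits n) (j : ℕ)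
    (h1 : cgkCounter s r j < n) (h2 : j < 3 * n) :
    cgkCounter s r (j + 1) = cgkCounter s r j +
      (if extendString s (cgkCounter s r j) then r ⟨2 * j + 1, by omega⟩
        else r ⟨2 * j, by omega⟩).toNat := by
  rw [cgkCounter, dif_pos ⟨h1, h2⟩]
  simp only [extendString, dif_pos h1]
  split_ifs with h <;> simp [h]

lemma cgkCounter_le_succ {n : ℕ} (s : Fin n → Bool) (r : WalkBits n) (j : ℕ) :
    cgkCounter s r j ≤ cgkCounter s r (j + 1) := by
  rw [cgkCounter]
  split_ifs
  · exact Nat.le_add_right _ _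
  · rfl

/-- Flipping bit `b` is an involution, and each `r` together with its flip shows both values of that
bit. -/
lemma sum_bits_update {m : ℕ} (F : (Fin m → Bool) → ℝ) (b : Fin m) :
    2 * ∑ r, F r = ∑ r, (F (Function.update r b false) + F (Function.update r b true)) := by
  have hinv : Function.Involutive fun r : Fin m → Bool => Function.update r b (!r b) := by
    intro r; simp
  have h := Equiv.sum_comp hinv.toPerm F
  rw [two_mul]
  nth_rewrite 1 [← h]
  rw [← Finset.sum_add_distrib]
  refine Finset.sum_congr rfl fun r _ => ?_
  simp only [Function.Involutive.coe_toPerm]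
  have e := Function.update_eq_self b r
  cases hb : r b <;> rw [hb] at e <;> simp only [Bool.not_false, Bool.not_true]
  · rw [e]; ring
  · rw [e]

lemma sum_bits_update_two {m : ℕ} (F : (Fin m → Bool) → ℝ) (b c : Fin m) :
    4 * ∑ r, F r = ∑ r,
      (F (Function.update (Function.update r b false) c false) +
        F (Function.update (Function.update r b false) c true) +
        F (Function.update (Function.update r b true) c false) +
        F (Function.update (Function.update r b true) c true)) := by
  have h1 := sum_bits_update F c
  have h2 := sum_bits_update
    (fun r => F (Function.update r c false) + F (Function.update r c true)) b
  rw [show (4 : ℝ) = 2 * 2 by norm_num, mul_assoc, h1, h2]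
  exact Finset.sum_congr rfl fun r _ => by ring

open Classical in
/-- The conditional probability of passing `(u, v)` given the first `j` steps. -/
noncomputable def passValue {n : ℕ} (s t : Fin n → Bool) (u v : Fin n) (j : ℕ)
    (r : WalkBits n) : ℝ :=
  if ∃ j' < j, cgkCounter s r j' = u ∧ cgkCounter t r j' = v then 1
  else passProb (extendString s) (extendString t) u v (3 * n - j)
    (cgkCounter s r j) (cgkCounter t r j)

/-- Step `j` reads only the bits 2j and 2j+1, on which the earlier counters do not depend. Averaging
over these two bits reproduces the recursion: equal characters read the same bit and move together,
unequal characters read two independent bits. -/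
lemma sum_passValue_succ_le {n : ℕ} (s t : Fin n → Bool) (u v : Fin n) {j : ℕ}
    (hj : j < 3 * n) :
    ∑ r, passValue s t u v (j + 1) r ≤ ∑ r, passValue s t u v j r := by
  have h4 := sum_bits_update_two (passValue s t u v (j + 1))
    ⟨2 * j, by omega⟩ ⟨2 * j + 1, by omega⟩
  suffices h : 4 * ∑ r, passValue s t u v (j + 1) r ≤ ∑ r, 4 * passValue s t u v j r by
    rw [← Finset.mul_sum] at h
    linarith
  rw [h4]
  refine Finset.sum_le_sum fun r _ => ?_
  let R (x y : Bool) : WalkBits n :=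
    Function.update (Function.update r ⟨2 * j, by omega⟩ x) ⟨2 * j + 1, by omega⟩ y
  change passValue s t u v (j + 1) (R false false) + passValue s t u v (j + 1) (R false true) +
    passValue s t u v (j + 1) (R true false) + passValue s t u v (j + 1) (R true true) ≤ _
  have hR (w : Fin n → Bool) (x y : Bool) (j' : ℕ) (hj' : j' ≤ j) :
      cgkCounter w (R x y) j' = cgkCounter w r j' := by
    apply cgkCounter_congr
    intro k hk
    have a1 : k ≠ ⟨2 * j + 1, by omega⟩ := by rw [ne_eq, Fin.ext_iff]; simp only; omega
    have a2 : k ≠ ⟨2 * j, by omega⟩ := by rw [ne_eq, Fin.ext_iff]; simp only; omega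
    simp [R, a1, a2]
  have hle (x y : Bool) : passValue s t u v (j + 1) (R x y) ≤ 1 := by
    unfold passValue; split_ifs
    · exact le_rfl
    · exact passProb_le_one _ _ _
  by_cases hp : ∃ j' < j + 1, cgkCounter s r j' = u ∧ cgkCounter t r j' = v
  · have : passValue s t u v j r = 1 := by
      unfold passValue
      split_ifs with h
      · rfl
      · obtain ⟨j', h1, h2⟩ := hp
        have : j' = j := by
          by_contra hne
          exact h ⟨j', by omega, h2⟩
        subst this
        rw [h2.1, h2.2, passProb_target]
    rw [this]
    linarith [hle false false, hle false true, hle true false, hle true true]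
  · have hnp (x y : Bool) : passValue s t u v (j + 1) (R x y) =
        passProb (extendString s) (extendString t) u v (3 * n - (j + 1))
          (cgkCounter s (R x y) (j + 1)) (cgkCounter t (R x y) (j + 1)) := by
      unfold passValue
      rw [if_neg]
      rintro ⟨j', h1, h2⟩
      rw [hR s x y j' (by omega), hR t x y j' (by omega)] at h2
      exact hp ⟨j', h1, h2⟩
    have hv : passValue s t u v j r = passProb (extendString s) (extendString t) u v
        (3 * n - (j + 1) + 1) (cgkCounter s r j) (cgkCounter t r j) := by
      unfold passValue
      rw [if_neg, show 3 * n - (j + 1) + 1 = 3 * n - j by omega]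
      rintro ⟨j', h1, h2⟩
      exact hp ⟨j', by omega, h2⟩
    have h1 : ¬ (cgkCounter s r j = u ∧ cgkCounter t r j = v) := fun h => hp ⟨j, by omega, h⟩
    rw [hv]
    simp only [hnp]
    -- Past the target the value stays 0, as counters never decrease. Otherwise both counters are
    -- below `n`, so the stopping rule plays no role.
    by_cases h2 : u.val < cgkCounter s r j ∨ v.val < cgkCounter t r j
    · rw [passProb_of_lt _ h2]
      have (x y : Bool) : u.val < cgkCounter s (R x y) (j + 1) ∨
          v.val < cgkCounter t (R x y) (j + 1) := by
        have a1 := cgkCounter_le_succ s (R x y) j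
        have a2 := cgkCounter_le_succ t (R x y) j
        rw [hR _ _ _ _ le_rfl] at a1 a2
        omega
      simp only [passProb_of_lt _ (this _ _)]
      norm_num
    · have hs (x y : Bool) : cgkCounter s (R x y) (j + 1) = cgkCounter s r j +
          (if extendString s (cgkCounter s r j) then y else x).toNat := by
        rw [cgkCounter_succ_of_lt _ _ _ (by rw [hR _ _ _ _ le_rfl]; omega) hj,
          hR _ _ _ _ le_rfl]
        simp [R]
      have ht (x y : Bool) : cgkCounter t (R x y) (j + 1) = cgkCounter t r j +
          (if extendString t (cgkCounter t r j) then y else x).toNat := by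
        rw [cgkCounter_succ_of_lt _ _ _ (by rw [hR _ _ _ _ le_rfl]; omega) hj,
          hR _ _ _ _ le_rfl]
        simp [R]
      simp only [hs, ht]
      by_cases h3 : extendString s (cgkCounter s r j) = extendString t (cgkCounter t r j)
      · rw [passProb_succ_match _ h1 h2 h3, h3]
        cases extendString t (cgkCounter t r j) <;> simp <;> linarith
      · rw [passProb_succ_mismatch _ h1 h2 h3]
        cases h5 : extendString t (cgkCounter t r j) <;>
          cases h6 : extendString s (cgkCounter s r j) <;> simp_all <;> linarith

-- The mean of `passValue` does not increase with time; at time 3n it dominates the indicator of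
-- passing, at time 0 it is `passProb`.
open Classical in
lemma card_walkPasses_le {n : ℕ} (s t : Fin n → Bool) (u v : Fin n) :
    ((Finset.univ.filter fun r : WalkBits n => WalkPasses s t r u v).card : ℝ) ≤
      Fintype.card (WalkBits n) *
        passProb (extendString s) (extendString t) u v (3 * n) 0 0 := by
  have key : ∀ j ≤ 3 * n, ∑ r, passValue s t u v j r ≤ ∑ r, passValue s t u v 0 r := by
    intro j
    induction j with
    | zero => intro _; rfl
    | succ j ih => intro hj; exact (sum_passValue_succ_le s t u v hj).trans (ih (by omega))
  have h0 : ∑ r, passValue s t u v 0 r = Fintype.card (WalkBits n) *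
      passProb (extendString s) (extendString t) u v (3 * n) 0 0 := by
    simp [passValue, cgkCounter]
  rw [← h0]
  refine le_trans ?_ (key _ le_rfl)
  rw [Finset.card_filter, Nat.cast_sum]
  refine Finset.sum_le_sum fun r _ => ?_
  unfold passValue WalkPasses
  split_ifs
  · simp
  · simpa using passProb_nonneg _ _ _

/-! ### The barrier argument -/

/-- The diagonal offset of `(i, j)` relative to the diagonal through `(u, v)`. -/
def diagOffset (u v i j : ℕ) : ℤ := (i : ℤ) - j + (v - u)

/-- The barrier potential: the positive part of `y`, capped at `c` and weighted by `m`. -/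
noncomputable def cappedWeight (m : ℝ) (c y : ℤ) : ℝ := m * ((min (max y 0) c : ℤ) : ℝ)

/-- Raising the slope and the plateau height raises the capped function, even if the cap itself
moves down. -/
lemma cappedWeight_mono {m m' : ℝ} {c c' : ℤ} (y : ℤ) (hm : 0 ≤ m) (hc : 0 ≤ c)
    (h1 : m ≤ m') (h2 : m * c ≤ m' * c') : cappedWeight m c y ≤ cappedWeight m' c' y := by
  unfold cappedWeight
  have h0 : (0 : ℝ) ≤ (min (max y 0) c : ℤ) := by exact_mod_cast le_min (le_max_right _ _) hc
  have h0' : (0 : ℝ) ≤ (max y 0 : ℤ) := by exact_mod_cast le_max_right _ _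
  rcases le_total (max y 0) c' with h | h
  · rw [min_eq_left h]
    have : ((min (max y 0) c : ℤ) : ℝ) ≤ (max y 0 : ℤ) := by exact_mod_cast min_le_left _ _
    calc _ ≤ m * ((max y 0 : ℤ) : ℝ) := by gcongr
      _ ≤ _ := by gcongr
  · rw [min_eq_right h]
    refine le_trans ?_ h2
    have : ((min (max y 0) c : ℤ) : ℝ) ≤ (c : ℝ) := by exact_mod_cast min_le_right _ _
    gcongr

lemma cappedWeight_le {m : ℝ} {c : ℤ} (y : ℤ) (hm : 0 ≤ m) : cappedWeight m c y ≤ m * c := by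
  unfold cappedWeight
  have : ((min (max y 0) c : ℤ) : ℝ) ≤ (c : ℝ) := by exact_mod_cast min_le_right _ _
  gcongr

/-- Away from its kink at `c` the potential is subharmonic. -/
lemma three_cappedWeight_le {m : ℝ} {c y : ℤ} (hm : 0 ≤ m) (hc : 0 ≤ c) (hy : y ≠ c) :
    3 * cappedWeight m c y ≤
      cappedWeight m c (y + 1) + cappedWeight m c y + cappedWeight m c (y - 1) := by
  unfold cappedWeight
  have h : 3 * min (max y 0) c ≤
      min (max (y + 1) 0) c + min (max y 0) c + min (max (y - 1) 0) c := by omega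
  have h' : (3 : ℝ) * (min (max y 0) c : ℤ) ≤
      (min (max (y + 1) 0) c : ℤ) + (min (max y 0) c : ℤ) + (min (max (y - 1) 0) c : ℤ) := by
    exact_mod_cast h
  nlinarith

/-- A walk that starts beside a lattice path (a "barrier") passes `(u, v)` with a probability that
is controlled by any weights `m` along the path which make the barrier potential subharmonic. -/
lemma passProb_le_of_weights {S T : ℕ → Bool} {u v i₀ j₀ L : ℕ} {a b : ℕ → ℕ} {m : ℕ → ℝ} {V : ℝ}
    (ha0 : a 0 = 0) (hb0 : b 0 = 0) (haL : u < a L) (hbL : v ≤ b L)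
    (hstep : ∀ l < L, a (l + 1) ≤ a l + 1 ∧ b (l + 1) ≤ b l + 1 ∧
      a l ≤ a (l + 1) ∧ b l ≤ b (l + 1))
    (hpos : ∀ l ≤ L, i₀ ≤ a l → j₀ ≤ b l → 0 ≤ m l ∧ 0 ≤ diagOffset u v (a l) (b l) ∧
      m l * diagOffset u v (a l) (b l) ≤ V)
    (hmono : ∀ l < L, i₀ ≤ a l → j₀ ≤ b l → m l ≤ m (l + 1) ∧
      m l * diagOffset u v (a l) (b l) ≤ m (l + 1) * diagOffset u v (a (l + 1)) (b (l + 1)))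
    (hmatch : ∀ l < L, a l ≤ u → b l ≤ v → S (a l) = T (b l) →
      a (l + 1) = a l + 1 ∧ b (l + 1) = b l + 1)
    (hedit : ∀ l < L, i₀ ≤ a l → j₀ ≤ b l → a l ≤ u → b l ≤ v → S (a l) ≠ T (b l) →
      3 * (m l * diagOffset u v (a l) (b l)) ≤
        cappedWeight (m (l + 1)) (diagOffset u v (a (l + 1)) (b (l + 1)))
          (diagOffset u v (a l) (b l) + 1) +
        cappedWeight (m (l + 1)) (diagOffset u v (a (l + 1)) (b (l + 1)))
          (diagOffset u v (a l) (b l)) +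
        cappedWeight (m (l + 1)) (diagOffset u v (a (l + 1)) (b (l + 1)))
          (diagOffset u v (a l) (b l) - 1))
    (t : ℕ) {i j l : ℕ} (hi₀ : i₀ ≤ i) (hj₀ : j₀ ≤ j) (hi : i ≤ u) (hj : j ≤ v) (hl : l ≤ L)
    (hil : i ≤ a l) (hjl : j ≤ b l) (hfirst : ∀ l' < l, ¬ (i ≤ a l' ∧ j ≤ b l')) :
    V * passProb S T u v t i j ≤
      V - cappedWeight (m l) (diagOffset u v (a l) (b l)) (diagOffset u v i j) := by
  set X : ℕ → ℤ := fun l => diagOffset u v (a l) (b l) with hX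
  have hmon : ∀ l l', l ≤ l' → l' ≤ L → i₀ ≤ a l → j₀ ≤ b l → ∀ y,
      cappedWeight (m l) (X l) y ≤ cappedWeight (m l') (X l') y := by
    intro l l' h
    induction l', h using Nat.le_induction with
    | base => intro _ _ _ y; rfl
    | succ l' h ih =>
      intro hl' h1 h2 y
      have hq : i₀ ≤ a l' ∧ j₀ ≤ b l' := by
        have : ∀ d, l + d ≤ L → i₀ ≤ a (l + d) ∧ j₀ ≤ b (l + d) := by
          intro d
          induction d with
          | zero => intro _; exact ⟨h1, h2⟩
          | succ d ihd =>
            intro hd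
            have e1 := ihd (by omega)
            have e2 := hstep (l + d) (by omega)
            rw [← add_assoc]
            omega
        have e := this (l' - l) (by omega)
        rwa [Nat.add_sub_cancel' h] at e
      have e2 := hstep l' (by omega)
      have e3 := hmono l' (by omega) hq.1 hq.2
      exact (ih (by omega) h1 h2 y).trans (cappedWeight_mono y (hpos l' (by omega) hq.1 hq.2).1
        (hpos l' (by omega) hq.1 hq.2).2.1 e3.1 e3.2)
  have hV : 0 ≤ V := by
    have := hpos l hl (by omega) (by omega)
    have h2 : (0 : ℝ) ≤ diagOffset u v (a l) (b l) := by exact_mod_cast this.2.1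
    exact (mul_nonneg this.1 h2).trans this.2.2
  induction t generalizing i j l with
  | zero =>
    have hp := hpos l hl (by omega) (by omega)
    unfold passProb
    split_ifs with h
    · have : diagOffset u v i j = 0 := by unfold diagOffset; omega
      have hc := hp.2.1
      simp [this, cappedWeight, hc]
    · linarith [cappedWeight_le (c := X l) (diagOffset u v i j) hp.1]
  | succ t ih =>
    have hp := hpos l hl (by omega) (by omega)
    by_cases h1 : i = u ∧ j = v
    · have : diagOffset u v i j = 0 := by unfold diagOffset; omega
      have hc := hp.2.1
      rw [this, h1.1, h1.2, passProb_target]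
      simp [cappedWeight, hc]
    have h2 : ¬ (u < i ∨ v < j) := by omega
    have hself := ih hi₀ hj₀ hi hj hl hil hjl hfirst
    -- By `hmon` the potential may be evaluated at any node `l'` not past the first one dominating
    -- the new position. Overshooting positions have pass probability 0, and the potential never
    -- exceeds `V`.
    have hnext : ∀ i' j' l', i ≤ i' → j ≤ j' → l' ≤ L → i₀ ≤ a l' → j₀ ≤ b l' →
        (∀ l'' < l', ¬ (i' ≤ a l'' ∧ j' ≤ b l'')) →
        V * passProb S T u v t i' j' ≤ V - cappedWeight (m l') (X l') (diagOffset u v i' j') := by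
      intro i' j' l' hi' hj' hl' h3 h4 h5
      by_cases h6 : u < i' ∨ v < j'
      · rw [passProb_of_lt _ h6]
        have := hpos l' hl' h3 h4
        linarith [cappedWeight_le (c := X l') (diagOffset u v i' j') this.1]
      · have hex : ∃ l, i' ≤ a l ∧ j' ≤ b l := ⟨L, by omega, by omega⟩
        have hf := Nat.find_spec hex
        have hmin : ∀ l'' < Nat.find hex, ¬ (i' ≤ a l'' ∧ j' ≤ b l'') :=
          fun l'' h => Nat.find_min hex h
        have hfL : Nat.find hex ≤ L := Nat.find_min' hex ⟨by omega, by omega⟩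
        have hge : l' ≤ Nat.find hex := by
          by_contra hlt
          exact h5 _ (by omega) hf
        have := ih (i := i') (j := j') (by omega) (by omega) (by omega) (by omega) hfL hf.1 hf.2
          hmin
        have hm := hmon l' _ hge hfL h3 h4 (diagOffset u v i' j')
        linarith
    have d10 : diagOffset u v (i + 1) j = diagOffset u v i j + 1 := by unfold diagOffset; omega
    have d01 : diagOffset u v i (j + 1) = diagOffset u v i j - 1 := by unfold diagOffset; omega
    have d11 : diagOffset u v (i + 1) (j + 1) = diagOffset u v i j := by
      unfold diagOffset; omega
    -- Only on the path is the kink felt: at a match the path moves along with the walk, at a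
    -- mismatch `hedit` compensates.
    by_cases hon : a l = i ∧ b l = j
    · have hlL : l < L := by
        rcases hl.lt_or_eq with h | h
        · exact h
        · subst h; omega
      have hst := hstep l hlL
      have hn : ∀ i' j', i ≤ i' → j ≤ j' → i + j < i' + j' → V * passProb S T u v t i' j' ≤
          V - cappedWeight (m (l + 1)) (X (l + 1)) (diagOffset u v i' j') := by
        intro i' j' hi' hj' hlt
        refine hnext i' j' (l + 1) hi' hj' hlL (by omega) (by omega) ?_
        intro l'' hl'' hd
        rcases Nat.lt_succ_iff_lt_or_eq.1 hl'' with h | h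
        · exact hfirst l'' h ⟨by omega, by omega⟩
        · subst h; omega
      have hx : X l = diagOffset u v i j := by simp only [hX, hon.1, hon.2]
      have hxv : cappedWeight (m l) (X l) (diagOffset u v i j) = m l * X l := by
        have := hp.2.1
        unfold cappedWeight
        rw [← hx, max_eq_left this, min_self]
      by_cases h3 : S i = T j
      · rw [passProb_succ_match t h1 h2 h3]
        have n11 := hn (i + 1) (j + 1) (by omega) (by omega) (by omega)
        rw [d11] at n11
        have hm := hmon l (l + 1) (by omega) hlL (by omega) (by omega) (diagOffset u v i j)
        linarith
      · rw [passProb_succ_mismatch t h1 h2 h3]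
        have n11 := hn (i + 1) (j + 1) (by omega) (by omega) (by omega)
        have n10 := hn (i + 1) j (by omega) (by omega) (by omega)
        have n01 := hn i (j + 1) (by omega) (by omega) (by omega)
        rw [d11] at n11
        rw [d10] at n10
        rw [d01] at n01
        have he := hedit l hlL (by omega) (by omega) (by omega) (by omega)
          (by rw [hon.1, hon.2]; exact h3)
        change 3 * (m l * X l) ≤ cappedWeight (m (l + 1)) (X (l + 1)) (X l + 1) +
          cappedWeight (m (l + 1)) (X (l + 1)) (X l) +
          cappedWeight (m (l + 1)) (X (l + 1)) (X l - 1) at he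
        rw [hx] at he
        rw [hxv] at hself ⊢
        rw [hx] at hself ⊢
        linarith
    · have hn : ∀ i' j', i ≤ i' → j ≤ j' → V * passProb S T u v t i' j' ≤
          V - cappedWeight (m l) (X l) (diagOffset u v i' j') := by
        intro i' j' hi' hj'
        exact hnext i' j' l hi' hj' hl (by omega) (by omega)
          fun l'' hl'' hd => hfirst l'' hl'' ⟨by omega, by omega⟩
      -- Path steps are at most one in each coordinate, so the first dominating node shares a
      -- coordinate with (i,j); lying on the same diagonal would put the walk on the path.
      have hne : diagOffset u v i j ≠ X l := by
        simp only [hX, diagOffset]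
        rcases Nat.eq_zero_or_pos l with h | h
        · subst h; omega
        · have hst := hstep (l - 1) (by omega)
          have hfi := hfirst (l - 1) (by omega)
          rw [Nat.sub_add_cancel h] at hst
          omega
      by_cases h3 : S i = T j
      · rw [passProb_succ_match t h1 h2 h3]
        have n11 := hn (i + 1) (j + 1) (by omega) (by omega)
        rw [d11] at n11
        linarith
      · rw [passProb_succ_mismatch t h1 h2 h3]
        have n11 := hn (i + 1) (j + 1) (by omega) (by omega)
        have n10 := hn (i + 1) j (by omega) (by omega)
        have n01 := hn i (j + 1) (by omega) (by omega)
        rw [d11] at n11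
        rw [d10] at n10
        rw [d01] at n01
        have := three_cappedWeight_le (m := m l) hp.1 hp.2.1 hne
        change 3 * cappedWeight (m l) (X l) (diagOffset u v i j) ≤ _ at this
        linarith

/-! ### Partial alignments and optimal lattice paths -/

/-- Partial alignments of the infinite strings `S` and `T` from the node `(i, j)`: they reach the
given node with the given number of edit operations. -/
inductive AlignSegment (S T : ℕ → Bool) (i j : ℕ) : ℕ → ℕ → ℕ → Prop
  | nil : AlignSegment S T i j i j 0
  | keep {i' j' c : ℕ} (h : AlignSegment S T i j i' j' c) (heq : S i' = T j') :
      AlignSegment S T i j (i' + 1) (j' + 1) c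
  | subst {i' j' c : ℕ} (h : AlignSegment S T i j i' j' c) :
      AlignSegment S T i j (i' + 1) (j' + 1) (c + 1)
  | delete {i' j' c : ℕ} (h : AlignSegment S T i j i' j' c) :
      AlignSegment S T i j (i' + 1) j' (c + 1)
  | ins {i' j' c : ℕ} (h : AlignSegment S T i j i' j' c) :
      AlignSegment S T i j i' (j' + 1) (c + 1)

namespace AlignSegment

variable {S T : ℕ → Bool} {i j i' j' c : ℕ}

lemma swap (h : AlignSegment S T i j i' j' c) : AlignSegment T S j i j' i' c := by
  induction h with
  | nil => exact nil
  | keep _ heq ih => exact ih.keep heq.symm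
  | subst _ ih => exact ih.subst
  | delete _ ih => exact ih.ins
  | ins _ ih => exact ih.delete

lemma deletes (h : AlignSegment S T i j i' j' c) (d : ℕ) :
    AlignSegment S T i j (i' + d) j' (c + d) := by
  induction d with
  | zero => exact h
  | succ d ih => exact ih.delete

lemma inserts (h : AlignSegment S T i j i' j' c) (d : ℕ) :
    AlignSegment S T i j i' (j' + d) (c + d) := by
  induction d with
  | zero => exact h
  | succ d ih => exact ih.ins

lemma keeps (h : AlignSegment S T i j i' j' c) (d : ℕ)
    (hd : ∀ k < d, S (i' + k) = T (j' + k)) : AlignSegment S T i j (i' + d) (j' + d) c := by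
  induction d with
  | zero => exact h
  | succ d ih => exact (ih fun k hk => hd k (by omega)).keep (hd d (by omega))

end AlignSegment

/-- An optimal alignment of the length `n` prefixes of `S` and `T`, given as a lattice path
`(a l, b l)` with running cost `C l ≤ K`, which keeps characters wherever it can. -/
structure OptimalPath (S T : ℕ → Bool) (n K N : ℕ) (a b C : ℕ → ℕ) : Prop where
  a_zero : a 0 = 0
  b_zero : b 0 = 0
  C_zero : C 0 = 0
  a_end : a N = n
  b_end : b N = n
  C_end : C N ≤ K
  step : ∀ l < N,
    (a (l + 1) = a l + 1 ∧ b (l + 1) = b l + 1 ∧ C (l + 1) = C l ∧ S (a l) = T (b l)) ∨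
    (a (l + 1) = a l + 1 ∧ b (l + 1) = b l + 1 ∧ C (l + 1) = C l + 1) ∨
    (a (l + 1) = a l + 1 ∧ b (l + 1) = b l ∧ C (l + 1) = C l + 1) ∨
    (a (l + 1) = a l ∧ b (l + 1) = b l + 1 ∧ C (l + 1) = C l + 1)
  forced : ∀ l < N, a l < n → b l < n → S (a l) = T (b l) →
    a (l + 1) = a l + 1 ∧ b (l + 1) = b l + 1 ∧ C (l + 1) = C l
  optimal : ∀ l₁ l₂, l₁ ≤ l₂ → l₂ ≤ N → ∀ c,
    AlignSegment S T (a l₁) (b l₁) (a l₂) (b l₂) c → C l₂ ≤ C l₁ + c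

namespace OptimalPath

variable {S T : ℕ → Bool} {n K N : ℕ} {a b C : ℕ → ℕ}

lemma swap (h : OptimalPath S T n K N a b C) : OptimalPath T S n K N b a C where
  a_zero := h.b_zero
  b_zero := h.a_zero
  C_zero := h.C_zero
  a_end := h.b_end
  b_end := h.a_end
  C_end := h.C_end
  step l hl := by
    rcases h.step l hl with ⟨h1, h2, h3, h4⟩ | ⟨h1, h2, h3⟩ | ⟨h1, h2, h3⟩ | ⟨h1, h2, h3⟩
    · exact Or.inl ⟨h2, h1, h3, h4.symm⟩
    · exact Or.inr (Or.inl ⟨h2, h1, h3⟩)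
    · exact Or.inr (Or.inr (Or.inr ⟨h2, h1, h3⟩))
    · exact Or.inr (Or.inr (Or.inl ⟨h2, h1, h3⟩))
  forced l hl h1 h2 h3 := by
    obtain ⟨e1, e2, e3⟩ := h.forced l hl h2 h1 h3.symm
    exact ⟨e2, e1, e3⟩
  optimal l₁ l₂ h1 h2 c hc := h.optimal l₁ l₂ h1 h2 c hc.swap

lemma step_le (h : OptimalPath S T n K N a b C) (l : ℕ) (hl : l < N) :
    a (l + 1) ≤ a l + 1 ∧ b (l + 1) ≤ b l + 1 ∧ a l ≤ a (l + 1) ∧ b l ≤ b (l + 1) := by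
  rcases h.step l hl with h | h | h | h <;> omega

/-- Only deletions and insertions change the diagonal, by one per unit of cost; this gives the last
two bounds. -/
lemma mono (h : OptimalPath S T n K N a b C) {l l' : ℕ} (hl : l ≤ l') (hl' : l' ≤ N) :
    a l ≤ a l' ∧ b l ≤ b l' ∧ C l ≤ C l' ∧
      (a l' : ℤ) - b l' - (a l - b l) ≤ C l' - C l ∧
      (a l : ℤ) - b l - (a l' - b l') ≤ C l' - C l := by
  induction l', hl using Nat.le_induction with
  | base => simp
  | succ l' hl ih =>
    have := ih (by omega)
    rcases h.step l' hl' with h | h | h | h <;> omega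

lemma abs_sub_le (h : OptimalPath S T n K N a b C) {l : ℕ} (hl : l ≤ N) :
    (a l : ℤ) - b l ≤ C l ∧ (b l : ℤ) - a l ≤ C l ∧ C l ≤ K := by
  have h1 := h.mono (Nat.zero_le l) hl
  have h2 := h.mono hl le_rfl
  have := h.C_end
  rw [h.a_zero, h.b_zero, h.C_zero] at h1
  push_cast at h1
  omega

lemma match_step (h : OptimalPath S T n K N a b C) {u v : ℕ} (hu : u < n) (hv : v < n) (l : ℕ)
    (hl : l < N) (h1 : a l ≤ u) (h2 : b l ≤ v) (h3 : S (a l) = T (b l)) :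
    a (l + 1) = a l + 1 ∧ b (l + 1) = b l + 1 :=
  ⟨(h.forced l hl (by omega) (by omega) h3).1, (h.forced l hl (by omega) (by omega) h3).2.1⟩

/-- A path that meets a run of matches follows it to its end. -/
lemma follows_run (h : OptimalPath S T n K N a b C) {i₀ j₀ r : ℕ} (hu : i₀ + r < n)
    (hv : j₀ + r < n) (hw : ∀ k ≤ r, S (i₀ + k) = T (j₀ + k)) {l k : ℕ} (hl : l ≤ N)
    (hk : k ≤ r) (ha : a l = i₀ + k) (hb : b l = j₀ + k) :
    ∃ l' ≤ N, a l' = i₀ + r ∧ b l' = j₀ + r := by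
  obtain ⟨d, rfl⟩ := Nat.exists_eq_add_of_le hk
  induction d generalizing l k with
  | zero => exact ⟨l, hl, ha, hb⟩
  | succ d ih =>
    have hlN : l < N := by
      rcases hl.lt_or_eq with h' | h'
      · exact h'
      · subst h'
        have := h.a_end
        omega
    have := h.forced l hlN (by omega) (by omega) (by rw [ha, hb]; exact hw k hk)
    have key := ih (l := l + 1) (k := k + 1) hlN (by omega) (by omega) (by omega) (by omega)
      (fun k' hk' => hw k' (by omega)) (by omega)
    rwa [show k + 1 + d = k + (d + 1) by omega] at key

end OptimalPath

/-! ### Edits on the barrier, and pairs far from the main diagonal -/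

lemma cappedWeight_of_le {m : ℝ} {c y : ℤ} (h0 : 0 ≤ y) (h : y ≤ c) :
    cappedWeight m c y = m * y := by
  unfold cappedWeight
  rw [max_eq_left h0, min_eq_left h]

lemma cappedWeight_of_ge {m : ℝ} {c y : ℤ} (h0 : 0 ≤ c) (h : c ≤ y) :
    cappedWeight m c y = m * c := by
  unfold cappedWeight
  rw [max_eq_left (h0.trans h), min_eq_right h]

/-- Here and in the next two lemmas an edit moves the barrier offset from x to x+1, x or x-1. The
last hypothesis is the weight increase that pays for what the new cap cuts off. -/
lemma three_mul_le_of_delete {m m' : ℝ} {x : ℤ} (hx : 1 ≤ x) (h : m ≤ m') :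
    3 * (m * x) ≤ cappedWeight m' (x + 1) (x + 1) + cappedWeight m' (x + 1) x +
      cappedWeight m' (x + 1) (x - 1) := by
  rw [cappedWeight_of_le (by omega) le_rfl, cappedWeight_of_le (by omega) (by omega),
    cappedWeight_of_le (by omega) (by omega)]
  have hx' : (1 : ℝ) ≤ x := by exact_mod_cast hx
  push_cast
  nlinarith

lemma three_mul_le_of_subst {m m' : ℝ} {x : ℤ} (hx : 1 ≤ x)
    (h : 3 * (m * x) ≤ m' * (3 * x - 1)) :
    3 * (m * x) ≤ cappedWeight m' x (x + 1) + cappedWeight m' x x + cappedWeight m' x (x - 1) := by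
  rw [cappedWeight_of_ge (by omega) (by omega), cappedWeight_of_le (by omega) le_rfl,
    cappedWeight_of_le (by omega) (by omega)]
  push_cast
  linarith

lemma three_mul_le_of_ins {m m' : ℝ} {x : ℤ} (hx : 1 ≤ x) (h : m * x ≤ m' * (x - 1)) :
    3 * (m * x) ≤ cappedWeight m' (x - 1) (x + 1) + cappedWeight m' (x - 1) x +
      cappedWeight m' (x - 1) (x - 1) := by
  rw [cappedWeight_of_ge (by omega) (by omega), cappedWeight_of_ge (by omega) (by omega),
    cappedWeight_of_ge (by omega) le_rfl]
  push_cast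
  linarith

/-- A pair far from the main diagonal is missed with constant probability. -/
lemma passProb_le_of_far {S T : ℕ → Bool} {n K N : ℕ} {a b C : ℕ → ℕ}
    (h : OptimalPath S T n K N a b C) (hK : 1 ≤ K) {u v : ℕ} (hu : u < n) (hv : v < n)
    (hfar : u + 3 * K < v) (t : ℕ) : passProb S T u v t 0 0 ≤ 1 - 3 / 8 := by
  have hK' : (1 : ℝ) ≤ K := by exact_mod_cast hK
  have hx : ∀ l ≤ N, 2 * (K : ℤ) + 1 ≤ diagOffset u v (a l) (b l) ∧
      diagOffset u v (a l) (b l) ≤ (v : ℤ) - u + K := by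
    intro l hl
    have := h.abs_sub_le hl
    unfold diagOffset
    omega
  have hd {l : ℕ} {e : ℤ} (he : diagOffset u v (a (l + 1)) (b (l + 1)) =
      diagOffset u v (a l) (b l) + e) : (diagOffset u v (a (l + 1)) (b (l + 1)) : ℝ) =
      diagOffset u v (a l) (b l) + e := by exact_mod_cast he
  -- The weight stays at most 2K while the barrier offset is at least 2K+1, which pays for every
  -- substitution and insertion. With d = v - u > 3K, the initial potential Kd is at least 3/8 of V
  -- = 2K(d+K).
  have key := passProb_le_of_weights (S := S) (T := T) (u := u) (v := v) (i₀ := 0) (j₀ := 0)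
    (L := N) (a := a) (b := b) (m := fun l => (K : ℝ) + C l)
    (V := 2 * K * ((v : ℝ) - u + K)) h.a_zero h.b_zero (by rw [h.a_end]; exact hu)
    (by rw [h.b_end]; omega) h.step_le ?_ ?_ (h.match_step hu hv) ?_ t (i := 0) (j := 0) (l := 0)
    le_rfl le_rfl (by omega) (by omega) (by omega) (by omega) (by omega) (by omega)
  · have e1 : diagOffset u v (a 0) (b 0) = v - u := by
      rw [h.a_zero, h.b_zero]; unfold diagOffset; omega
    have e2 : diagOffset u v 0 0 = v - u := by unfold diagOffset; omega
    rw [e1, e2, cappedWeight_of_le (by omega) le_rfl, h.C_zero] at key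
    push_cast at key
    have hf : (u : ℝ) + 3 * K < v := by exact_mod_cast hfar
    have hp := passProb_nonneg (S := S) (T := T) (u := u) (v := v) t 0 0
    set p := passProb S T u v t 0 0
    have hpos : 0 < 2 * (K : ℝ) * (v - u + K) := by nlinarith
    have : 2 * (K : ℝ) * (v - u + K) * (1 - p) ≥ 2 * (K : ℝ) * (v - u + K) * (3 / 8) := by
      nlinarith
    linarith [le_of_mul_le_mul_left this hpos]
  · intro l hl _ _
    have h1 := hx l hl
    have h2 := h.abs_sub_le hl
    have h3 : (diagOffset u v (a l) (b l) : ℝ) ≤ v - u + K := by exact_mod_cast h1.2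
    have h4 : (0 : ℝ) ≤ diagOffset u v (a l) (b l) := by
      have : 0 ≤ diagOffset u v (a l) (b l) := by omega
      exact_mod_cast this
    have h5 : (C l : ℝ) ≤ K := by exact_mod_cast h2.2.2
    refine ⟨by positivity, by omega, ?_⟩
    gcongr
    linarith
  · intro l hl _ _
    have h1 := (hx l hl.le).1
    have h2 := (h.abs_sub_le (show l + 1 ≤ N from hl)).2.2
    have h1' : 2 * (K : ℝ) + 1 ≤ diagOffset u v (a l) (b l) := by exact_mod_cast h1
    have h2' : (C (l + 1) : ℝ) ≤ K := by exact_mod_cast h2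
    have hC0 : (0 : ℝ) ≤ C l := by positivity
    rcases h.step l hl with ⟨s1, s2, s3, -⟩ | ⟨s1, s2, s3⟩ | ⟨s1, s2, s3⟩ | ⟨s1, s2, s3⟩
    · rw [hd (e := 0) (by rw [s1, s2]; unfold diagOffset; push_cast; ring), s3]; simp
    · rw [hd (e := 0) (by rw [s1, s2]; unfold diagOffset; push_cast; ring)]
      rw [s3] at h2' ⊢
      push_cast at h2' ⊢
      constructor <;> nlinarith
    · rw [hd (e := 1) (by rw [s1, s2]; unfold diagOffset; push_cast; ring)]
      rw [s3] at h2' ⊢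
      push_cast at h2' ⊢
      constructor <;> nlinarith
    · rw [hd (e := -1) (by rw [s1, s2]; unfold diagOffset; push_cast; ring)]
      rw [s3] at h2' ⊢
      push_cast at h2' ⊢
      constructor <;> nlinarith
  · intro l hl _ _ _ _ hne
    have h1 := (hx l hl.le).1
    have h2 := (h.abs_sub_le (show l + 1 ≤ N from hl)).2.2
    have h1' : 2 * (K : ℝ) + 1 ≤ diagOffset u v (a l) (b l) := by exact_mod_cast h1
    have h2' : (C (l + 1) : ℝ) ≤ K := by exact_mod_cast h2
    have hC0 : (0 : ℝ) ≤ C l := by positivity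
    rcases h.step l hl with ⟨s1, s2, s3, s4⟩ | ⟨s1, s2, s3⟩ | ⟨s1, s2, s3⟩ | ⟨s1, s2, s3⟩
    · exact absurd s4 hne
    · have e : diagOffset u v (a (l + 1)) (b (l + 1)) = diagOffset u v (a l) (b l) := by
        rw [s1, s2]; unfold diagOffset; push_cast; ring
      rw [e]
      apply three_mul_le_of_subst (by omega)
      rw [s3] at h2' ⊢
      push_cast at h2' ⊢
      nlinarith
    · have e : diagOffset u v (a (l + 1)) (b (l + 1)) = diagOffset u v (a l) (b l) + 1 := by
        rw [s1, s2]; unfold diagOffset; push_cast; ring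
      rw [e]
      apply three_mul_le_of_delete (by omega)
      rw [s3]
      push_cast
      linarith
    · have e : diagOffset u v (a (l + 1)) (b (l + 1)) = diagOffset u v (a l) (b l) - 1 := by
        rw [s1, s2]; unfold diagOffset; push_cast; ring
      rw [e]
      apply three_mul_le_of_ins (by omega)
      rw [s3] at h2' ⊢
      push_cast at h2' ⊢
      nlinarith

/-! ### The barrier beside a run of matches -/

/-- A maximal run of matches ending in a given match. -/
lemma exists_maximal_run {S T : ℕ → Bool} (u v : ℕ) (h : S u = T v) :
    ∃ r i₀ j₀, u = i₀ + r ∧ v = j₀ + r ∧ (∀ k ≤ r, S (i₀ + k) = T (j₀ + k)) ∧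
      ∀ i j, i₀ = i + 1 → j₀ = j + 1 → S i ≠ T j := by
  induction u generalizing v with
  | zero => exact ⟨0, 0, v, rfl, rfl, fun k hk => by simpa [Nat.le_zero.1 hk] using h, by simp⟩
  | succ u ih =>
    cases v with
    | zero =>
      exact ⟨0, u + 1, 0, rfl, rfl, fun k hk => by simpa [Nat.le_zero.1 hk] using h, by simp⟩
    | succ v =>
      by_cases h' : S u = T v
      · obtain ⟨r, i₀, j₀, rfl, rfl, h3, h4⟩ := ih v h'
        refine ⟨r + 1, i₀, j₀, rfl, rfl, fun k hk => ?_, h4⟩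
        rcases Nat.le_succ_iff.1 hk with hk | rfl
        · exact h3 k hk
        · exact h
      · refine ⟨0, u + 1, v + 1, rfl, rfl, fun k hk => by simpa [Nat.le_zero.1 hk] using h, ?_⟩
        intro i j hi hj
        cases hi; cases hj
        exact h'

/-- The weight of a barrier node at diagonal offset `x` with remaining excess cost `E`. -/
noncomputable def barrierWeight (x E : ℤ) : ℝ := if E = 0 then 2 else 1 - (E - 1) / (2 * x)

lemma barrierWeight_zero (x : ℤ) : barrierWeight x 0 = 2 := by simp [barrierWeight]

lemma barrierWeight_mul {x E : ℤ} (hx : 1 ≤ x) (hE : 1 ≤ E) :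
    barrierWeight x E * x = x - (E - 1) / 2 := by
  have hx' : (1 : ℝ) ≤ x := by exact_mod_cast hx
  rw [barrierWeight, if_neg (by omega)]
  field_simp

/-- The bound E ≤ 2x, which will come from optimality of the path, is what keeps the barrier height
bounded away from 0. -/
lemma barrierWeight_mul_ge {x E : ℤ} (hx : 1 ≤ x) (hE : 0 ≤ E) (h : E ≤ 2 * x) :
    1 / 2 ≤ barrierWeight x E * x := by
  have hx' : (1 : ℝ) ≤ x := by exact_mod_cast hx
  rcases hE.eq_or_lt with rfl | hE
  · rw [barrierWeight_zero]; linarith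
  · rw [barrierWeight_mul hx hE]
    have : (E : ℝ) ≤ 2 * x := by exact_mod_cast h
    linarith

lemma barrierWeight_le {x E : ℤ} (hx : 1 ≤ x) (hE : 0 ≤ E) : barrierWeight x E ≤ 2 := by
  rcases hE.eq_or_lt with rfl | hE
  · rw [barrierWeight_zero]
  · have hx' : (1 : ℝ) ≤ x := by exact_mod_cast hx
    have hE' : (1 : ℝ) ≤ E := by exact_mod_cast hE
    rw [barrierWeight, if_neg (by omega)]
    have : 0 ≤ ((E : ℝ) - 1) / (2 * x) := div_nonneg (by linarith) (by linarith)
    linarith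

lemma barrierWeight_pos {x E : ℤ} (hx : 1 ≤ x) (hE : 0 ≤ E) (h : E ≤ 2 * x) :
    0 < barrierWeight x E := by
  have h1 := barrierWeight_mul_ge hx hE h
  have hx' : (0 : ℝ) < x := by exact_mod_cast hx
  by_contra h2
  nlinarith

/-- A deletion leaves the excess E unchanged, a substitution lowers it by 1, an insertion by 2. At E
= 0 the general formula would be 1 + 1/(2x), which decreases under deletions; hence the constant
there. -/
lemma barrierWeight_delete {x E : ℤ} (hx : 1 ≤ x) (hE : 0 ≤ E) :
    barrierWeight x E ≤ barrierWeight (x + 1) E := by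
  rcases hE.eq_or_lt with rfl | hE
  · rw [barrierWeight_zero, barrierWeight_zero]
  · have hx' : (1 : ℝ) ≤ x := by exact_mod_cast hx
    have hE' : (0 : ℝ) ≤ (E : ℝ) - 1 := by
      have : (1 : ℝ) ≤ E := by exact_mod_cast hE
      linarith
    rw [barrierWeight, if_neg (by omega), barrierWeight, if_neg (by omega)]
    push_cast
    gcongr
    linarith

lemma barrierWeight_subst {x E : ℤ} (hx : 1 ≤ x) (hE : 1 ≤ E) :
    barrierWeight x E ≤ barrierWeight x (E - 1) ∧
      3 * (barrierWeight x E * x) ≤ barrierWeight x (E - 1) * (3 * x - 1) := by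
  have hx' : (1 : ℝ) ≤ x := by exact_mod_cast hx
  rcases hE.eq_or_lt with rfl | hE
  · rw [barrierWeight_mul hx le_rfl, show (1 : ℤ) - 1 = 0 by norm_num, barrierWeight_zero]
    refine ⟨barrierWeight_le hx (by norm_num), ?_⟩
    push_cast
    linarith
  · have hE' : (2 : ℝ) ≤ E := by exact_mod_cast hE
    constructor
    · rw [barrierWeight, if_neg (by omega), barrierWeight, if_neg (by omega)]
      push_cast
      gcongr
      linarith
    · rw [barrierWeight_mul hx (by omega), barrierWeight, if_neg (by omega)]
      push_cast
      have : (1 - ((E : ℝ) - 1 - 1) / (2 * x)) * (3 * x - 1) -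
          3 * (x - (E - 1) / 2) = (x + E - 2) / (2 * x) := by
        field_simp
        ring
      have h2 : 0 ≤ ((x : ℝ) + E - 2) / (2 * x) := div_nonneg (by linarith) (by linarith)
      linarith

lemma barrierWeight_ins {x E : ℤ} (hx : 2 ≤ x) (hE : 2 ≤ E) (h : E ≤ 2 * x) :
    barrierWeight x E ≤ barrierWeight (x - 1) (E - 2) ∧
      barrierWeight x E * x ≤ barrierWeight (x - 1) (E - 2) * (x - 1) := by
  have hx' : (2 : ℝ) ≤ x := by exact_mod_cast hx
  rcases hE.eq_or_lt with rfl | hE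
  · rw [barrierWeight_mul (by omega) (by norm_num), show (2 : ℤ) - 2 = 0 by norm_num,
      barrierWeight_zero]
    refine ⟨barrierWeight_le (by omega) (by norm_num), ?_⟩
    push_cast
    linarith
  · have h' : (E : ℝ) ≤ 2 * x := by exact_mod_cast h
    constructor
    · rw [barrierWeight, if_neg (by omega), barrierWeight, if_neg (by omega)]
      push_cast
      have : ((E : ℝ) - 2 - 1) / (2 * (x - 1)) ≤ (E - 1) / (2 * x) := by
        rw [div_le_div_iff₀ (by linarith) (by linarith)]
        nlinarith
      linarith
    · have := barrierWeight_mul (x := x - 1) (E := E - 2) (by omega) (by omega)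
      push_cast at this
      rw [this, barrierWeight_mul (by omega) (by omega)]
      linarith

/-- The walk started next to a run of matches that ends in `(u, v)` and is avoided by an optimal
path, on the side of the path, misses `(u, v)` with probability `Ω(1 / K²)`. -/
lemma passProb_le_beside_run {S T : ℕ → Bool} {n K N : ℕ} {a b C : ℕ → ℕ}
    (h : OptimalPath S T n K N a b C) (hK : 1 ≤ K) {u v i₀ j₀ r : ℕ} (hu : u < n) (hv : v < n)
    (hur : u = i₀ + r) (hvr : v = j₀ + r) (hw : ∀ k ≤ r, S (i₀ + k) = T (j₀ + k))
    (hnear : (v : ℤ) - u ≤ 3 * K)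
    (hoff : ∀ l ≤ N, ∀ k ≤ r, ¬ (a l = i₀ + k ∧ b l = j₀ + k))
    {l₀ : ℕ} (hl₀ : l₀ ≤ N) (hent : i₀ ≤ a l₀ ∧ j₀ ≤ b l₀)
    (hbefore : ∀ l < l₀, ¬ (i₀ ≤ a l ∧ j₀ ≤ b l)) (hside : a l₀ + j₀ > b l₀ + i₀)
    (t : ℕ) {k k' : ℕ} (hk : k ≤ r) (hkk : k' < k) :
    passProb S T u v t (i₀ + k) (j₀ + k') ≤ 1 - 1 / (64 * (K : ℝ) ^ 2) := by
  -- The barrier ends at `L`, the first node from the entry on whose second coordinate reaches `v`.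
  have hex : ∃ l, l₀ ≤ l ∧ v ≤ b l := ⟨N, hl₀, by rw [h.b_end]; omega⟩
  obtain ⟨L, hLdef⟩ : ∃ L, L = Nat.find hex := ⟨_, rfl⟩
  have hLN : L ≤ N := by rw [hLdef]; exact Nat.find_min' hex ⟨hl₀, by rw [h.b_end]; omega⟩
  have hLs : l₀ ≤ L ∧ v ≤ b L := by rw [hLdef]; exact Nat.find_spec hex
  have hLm : ∀ l, l₀ ≤ l → l < L → b l < v := by
    intro l h1 h2
    rw [hLdef] at h2
    have := Nat.find_min hex h2
    omega
  have hquad : ∀ l, l₀ ≤ l → l ≤ N → i₀ ≤ a l ∧ j₀ ≤ b l := by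
    intro l h1 h2
    have := h.mono h1 h2
    omega
  have hl₀' : ∀ l, i₀ ≤ a l → j₀ ≤ b l → l₀ ≤ l := by
    intro l h1 h2
    by_contra h3
    exact hbefore l (by omega) ⟨h1, h2⟩
  let x : ℕ → ℤ := fun l => diagOffset u v (a l) (b l)
  have hxdef : ∀ l, x l = (a l : ℤ) - i₀ - (b l - j₀) := by
    intro l; simp only [x, diagOffset]; omega
  -- Each step changes the offset by at most one, so reaching the diagonal by time `L` would mean
  -- landing on the run.
  have hx1 : ∀ l, l₀ ≤ l → l ≤ L → 1 ≤ x l := by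
    intro l hl
    induction l, hl using Nat.le_induction with
    | base => intro _; rw [hxdef]; omega
    | succ l hl ih =>
      intro hlL
      have h1 := ih (by omega)
      have h2 := hLm l hl hlL
      have h3 := h.step_le l (by omega)
      have h4 := hquad l hl (by omega)
      rw [hxdef] at h1 ⊢
      by_contra h5
      exact hoff (l + 1) (by omega) (b (l + 1) - j₀) (by omega) ⟨by omega, by omega⟩
  have hbL : b L = v := by
    rcases hLs.1.eq_or_lt with h1 | h1
    · rw [← h1]
      have h2 : l₀ ≠ 0 := by
        rintro rfl
        rw [h.a_zero, h.b_zero] at *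
        omega
      have h3 := hbefore (l₀ - 1) (by omega)
      have h4 := h.step_le (l₀ - 1) (by omega)
      rw [Nat.sub_add_cancel (by omega)] at h4
      have := hLs.2
      rw [← h1] at this
      omega
    · have h2 := hLm (L - 1) (by omega) (by omega)
      have h3 := h.step_le (L - 1) (by omega)
      rw [Nat.sub_add_cancel (by omega)] at h3
      omega
  have haL : u < a L := by
    have := hx1 L hLs.1 le_rfl
    rw [hxdef] at this
    omega
  -- The cost still to be paid up to `L`, minus the net gain in offset up to `L`.
  let E : ℕ → ℤ := fun l => (C L : ℤ) - C l - x L + x l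
  have hE0 : ∀ l, l ≤ L → 0 ≤ E l := by
    intro l hl
    have := h.mono hl hLN
    simp only [E, hxdef]
    omega
  -- The competitor inserts `x l` characters to reach the run, follows it for free to (u,v), and
  -- deletes `x L` characters. Beyond `u`, plain deletions and insertions are cheap enough.
  have hE2 : ∀ l, l₀ ≤ l → l ≤ L → E l ≤ 2 * x l := by
    intro l h1 h2
    have hq := hquad l h1 (by omega)
    have hx := hx1 l h1 h2
    have hm := h.mono h2 hLN
    have hxL := hx1 L hLs.1 le_rfl
    have hopt := h.optimal l L h2 hLN
    simp only [E]
    rw [hxdef] at hx hxL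
    rw [hxdef, hxdef]
    have hd0 : AlignSegment S T (a l) (b l) (a l) (b l) 0 := AlignSegment.nil
    by_cases hkr : a l ≤ u
    · have s1 := hd0.inserts (a l - i₀ - (b l - j₀))
      have s2 := s1.keeps (u - a l) (by
        intro k hk
        have := hw (a l - i₀ + k) (by omega)
        rw [show i₀ + (a l - i₀ + k) = a l + k by omega,
          show j₀ + (a l - i₀ + k) = b l + (a l - i₀ - (b l - j₀)) + k by omega] at this
        exact this)
      have s3 := s2.deletes (a L - u)
      have := hopt (0 + (a l - i₀ - (b l - j₀)) + (a L - u)) (by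
        convert s3 using 1 <;> omega)
      omega
    · have s1 := (hd0.deletes (a L - a l)).inserts (b L - b l)
      have := hopt (0 + (a L - a l) + (b L - b l)) (by convert s1 using 1 <;> omega)
      omega
  have hx4 : ∀ l, l ≤ N → x l ≤ 4 * K := by
    intro l hl
    have := h.abs_sub_le hl
    simp only [x, diagOffset]
    omega
  have hK' : (1 : ℝ) ≤ K := by exact_mod_cast hK
  have hsteps : ∀ l, l₀ ≤ l → l < L →
      (x (l + 1) = x l ∧ E (l + 1) = E l ∧ S (a l) = T (b l)) ∨
      (x (l + 1) = x l ∧ E (l + 1) = E l - 1) ∨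
      (x (l + 1) = x l + 1 ∧ E (l + 1) = E l) ∨
      (x (l + 1) = x l - 1 ∧ E (l + 1) = E l - 2) := by
    intro l _ h2
    simp only [E, hxdef]
    rcases h.step l (by omega) with ⟨s1, s2, s3, s4⟩ | ⟨s1, s2, s3⟩ | ⟨s1, s2, s3⟩ | ⟨s1, s2, s3⟩
    · exact Or.inl ⟨by omega, by omega, s4⟩
    · exact Or.inr (Or.inl ⟨by omega, by omega⟩)
    · exact Or.inr (Or.inr (Or.inl ⟨by omega, by omega⟩))
    · exact Or.inr (Or.inr (Or.inr ⟨by omega, by omega⟩))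
  have hfex : ∃ l, i₀ + k ≤ a l ∧ j₀ + k' ≤ b l := ⟨L, by omega, by omega⟩
  have hf := Nat.find_spec hfex
  have hfL : Nat.find hfex ≤ L := Nat.find_min' hfex ⟨by omega, by omega⟩
  -- V = 8K since weights are at most 2 and offsets at most 4K. Weight times offset is at least 1/2,
  -- so the initial potential is at least 1/(8K), and the ratio is 1/(64K²).
  have key := passProb_le_of_weights (S := S) (T := T) (u := u) (v := v) (i₀ := i₀) (j₀ := j₀)
    (L := L) (a := a) (b := b) (m := fun l => barrierWeight (x l) (E l))
    (V := 8 * K) h.a_zero h.b_zero haL hbL.ge (fun l hl => h.step_le l (by omega)) ?_ ?_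
    (fun l hl => h.match_step hu hv l (by omega)) ?_ t (i := i₀ + k) (j := j₀ + k')
    (l := Nat.find hfex) (by omega) (by omega) (by omega) (by omega) hfL hf.1 hf.2
    (fun l' hl' => Nat.find_min hfex hl')
  · set l := Nat.find hfex
    have hll : l₀ ≤ l := hl₀' l (by omega) (by omega)
    have hx := hx1 l hll hfL
    have hx' : (1 : ℝ) ≤ x l := by exact_mod_cast hx
    have hxK : (x l : ℝ) ≤ 4 * K := by exact_mod_cast hx4 l (by omega)
    have hw0 := barrierWeight_pos hx (hE0 l hfL) (hE2 l hll hfL)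
    have hw1 := barrierWeight_mul_ge hx (hE0 l hfL) (hE2 l hll hfL)
    have hmin : (1 : ℝ) ≤ (min (max (diagOffset u v (i₀ + k) (j₀ + k')) 0) (x l) : ℤ) := by
      have : 1 ≤ diagOffset u v (i₀ + k) (j₀ + k') := by unfold diagOffset; omega
      have : 1 ≤ min (max (diagOffset u v (i₀ + k) (j₀ + k')) 0) (x l) := by omega
      exact_mod_cast this
    have hc : barrierWeight (x l) (E l) ≤ cappedWeight (barrierWeight (x l) (E l))
        (diagOffset u v (a l) (b l)) (diagOffset u v (i₀ + k) (j₀ + k')) := by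
      unfold cappedWeight
      change _ ≤ _ * ((min (max (diagOffset u v (i₀ + k) (j₀ + k')) 0) (x l) : ℤ) : ℝ)
      nlinarith
    set p := passProb S T u v t (i₀ + k) (j₀ + k')
    have hge : 1 / (8 * (K : ℝ)) ≤ barrierWeight (x l) (E l) := by
      rw [div_le_iff₀ (by linarith)]
      nlinarith
    have h64 : 1 / (64 * (K : ℝ) ^ 2) * (8 * K) = 1 / (8 * K) := by
      field_simp
      norm_num
    have : 8 * (K : ℝ) * p ≤ 8 * (K : ℝ) * (1 - 1 / (64 * (K : ℝ) ^ 2)) := by linarith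
    exact le_of_mul_le_mul_left this (by linarith)
  · intro l hl h1 h2
    have hll := hl₀' l h1 h2
    have hx := hx1 l hll hl
    have hx' : (1 : ℝ) ≤ x l := by exact_mod_cast hx
    have hxK : (x l : ℝ) ≤ 4 * K := by exact_mod_cast hx4 l (by omega)
    have hw2 := barrierWeight_le hx (hE0 l hl)
    refine ⟨(barrierWeight_pos hx (hE0 l hl) (hE2 l hll hl)).le, by
      change 0 ≤ x l; omega, ?_⟩
    change barrierWeight (x l) (E l) * (x l : ℝ) ≤ _
    nlinarith
  · intro l hl h1 h2
    change barrierWeight (x l) (E l) ≤ barrierWeight (x (l + 1)) (E (l + 1)) ∧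
      barrierWeight (x l) (E l) * (x l : ℝ) ≤ barrierWeight (x (l + 1)) (E (l + 1)) * (x (l + 1) : ℝ)
    have hll := hl₀' l h1 h2
    have hx := hx1 l hll hl.le
    have hx' : (1 : ℝ) ≤ x l := by exact_mod_cast hx
    have hxn := hx1 (l + 1) (by omega) hl
    have hEn := hE0 (l + 1) hl
    have hE := hE0 l hl.le
    have hE' := hE2 l hll hl.le
    have hpos := barrierWeight_pos hx hE hE'
    rcases hsteps l hll hl with ⟨s1, s2, -⟩ | ⟨s1, s2⟩ | ⟨s1, s2⟩ | ⟨s1, s2⟩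
    · rw [s1, s2]; exact ⟨le_rfl, le_rfl⟩
    · rw [s1, s2]
      have := (barrierWeight_subst hx (E := E l) (by omega)).1
      exact ⟨this, by gcongr⟩
    · rw [s1, s2]
      have := barrierWeight_delete hx hE
      refine ⟨this, ?_⟩
      push_cast
      nlinarith
    · rw [s1, s2]
      have := barrierWeight_ins (x := x l) (E := E l) (by omega) (by omega) hE'
      refine ⟨this.1, ?_⟩
      push_cast
      exact this.2
  · intro l hl h1 h2 _ _ hne
    change 3 * (barrierWeight (x l) (E l) * (x l : ℝ)) ≤
      cappedWeight (barrierWeight (x (l + 1)) (E (l + 1))) (x (l + 1)) (x l + 1) +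
      cappedWeight (barrierWeight (x (l + 1)) (E (l + 1))) (x (l + 1)) (x l) +
      cappedWeight (barrierWeight (x (l + 1)) (E (l + 1))) (x (l + 1)) (x l - 1)
    have hll := hl₀' l h1 h2
    have hx := hx1 l hll hl.le
    have hxn := hx1 (l + 1) (by omega) hl
    have hEn := hE0 (l + 1) hl
    have hE := hE0 l hl.le
    have hE' := hE2 l hll hl.le
    rcases hsteps l hll hl with ⟨-, -, s3⟩ | ⟨s1, s2⟩ | ⟨s1, s2⟩ | ⟨s1, s2⟩
    · exact absurd s3 hne
    · rw [s1, s2]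
      exact three_mul_le_of_subst hx (barrierWeight_subst hx (by omega)).2
    · rw [s1, s2]
      exact three_mul_le_of_delete hx (barrierWeight_delete hx hE)
    · rw [s1, s2]
      exact three_mul_le_of_ins hx
        (barrierWeight_ins (x := x l) (E := E l) (by omega) (by omega) hE').2

/-! ### Entering the square, and the bound for a single walk -/

/-- A walk that starts outside the square spanned by a maximal run of matches enters the square
away from the run with constant probability. -/
lemma passProb_le_of_run {S T : ℕ → Bool} {u v i₀ j₀ r : ℕ}
    (hur : u = i₀ + r) (hvr : v = j₀ + r)
    (hmax : ∀ i j, i₀ = i + 1 → j₀ = j + 1 → S i ≠ T j) {η : ℝ} (hη : 0 ≤ η) (hη1 : η ≤ 1)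
    (hbox : ∀ t k k', k ≤ r → k' ≤ r → k ≠ k' →
      passProb S T u v t (i₀ + k) (j₀ + k') ≤ 1 - η) (t : ℕ) {i j : ℕ} (hij : i < i₀ ∨ j < j₀) :
    passProb S T u v t i j ≤ 1 - 2 / 9 * η := by
  -- In units of η, a neighbour of the corner (i₀,j₀) gains 1/3 from its diagonal move alone,
  -- solving y = (y + 1)/4. The cell diagonally before the corner then gains 2/9, solving y = (y +
  -- 2/3)/4; its move into the corner counts for nothing.
  suffices H : ∀ t i j, (i < i₀ ∨ j < j₀) → passProb S T u v t i j ≤ 1 - 2 / 9 * η ∧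
      ((i + 1 = i₀ ∧ j = j₀) ∨ (i = i₀ ∧ j + 1 = j₀) → passProb S T u v t i j ≤ 1 - η / 3) from
    (H t i j hij).1
  clear hij i j t
  intro t
  induction t with
  | zero =>
    intro i j hij
    have : passProb S T u v 0 i j = 0 := by
      unfold passProb; rw [if_neg]; omega
    rw [this]
    constructor
    · linarith
    · intro _; linarith
  | succ t ih =>
    intro i j hij
    by_cases h2 : u < i ∨ v < j
    · rw [passProb_of_lt _ h2]
      constructor
      · linarith
      · intro _; linarith
    have h1 : ¬ (i = u ∧ j = v) := by omega
    have hin : ∀ i' j', i₀ ≤ i' → j₀ ≤ j' → i' + j₀ ≠ j' + i₀ →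
        passProb S T u v t i' j' ≤ 1 - η := by
      intro i' j' h3 h4 h5
      by_cases h6 : u < i' ∨ v < j'
      · rw [passProb_of_lt _ h6]; linarith
      · have := hbox t (i' - i₀) (j' - j₀) (by omega) (by omega) (by omega)
        rwa [Nat.add_sub_cancel' h3, Nat.add_sub_cancel' h4] at this
    have hall : ∀ i' j', i' ≤ i + 1 → j' ≤ j + 1 → ¬ (i' = i₀ ∧ j' = j₀) → i ≤ i' → j ≤ j' →
        passProb S T u v t i' j' ≤ 1 - 2 / 9 * η := by
      intro i' j' h3 h4 h5 _ _
      by_cases h6 : i' < i₀ ∨ j' < j₀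
      · exact (ih i' j' h6).1
      · have := hin i' j' (by omega) (by omega) (by omega)
        linarith
    have hself := ih i j hij
    have hadj : (i + 1 = i₀ ∧ j = j₀) ∨ (i = i₀ ∧ j + 1 = j₀) →
        passProb S T u v (t + 1) i j ≤ 1 - η / 3 := by
      intro hA
      have hs := hself.2 hA
      have h11 := hin (i + 1) (j + 1) (by omega) (by omega) (by omega)
      by_cases h3 : S i = T j
      · rw [passProb_succ_match t h1 h2 h3]; linarith
      · rw [passProb_succ_mismatch t h1 h2 h3]
        rcases hA with hA | hA
        · have h01 := hall i (j + 1) (by omega) (by omega) (by omega) (by omega) (by omega)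
          have h10 := passProb_le_one (S := S) (T := T) (u := u) (v := v) t (i + 1) j
          linarith
        · have h10 := hall (i + 1) j (by omega) (by omega) (by omega) (by omega) (by omega)
          have h01 := passProb_le_one (S := S) (T := T) (u := u) (v := v) t i (j + 1)
          linarith
    refine ⟨?_, hadj⟩
    by_cases hA : (i + 1 = i₀ ∧ j = j₀) ∨ (i = i₀ ∧ j + 1 = j₀)
    · linarith [hadj hA]
    by_cases hc : i + 1 = i₀ ∧ j + 1 = j₀
    · rw [passProb_succ_mismatch t h1 h2 (hmax i j hc.1.symm hc.2.symm)]
      have h10 := (ih (i + 1) j (by omega)).2 (by omega)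
      have h01 := (ih i (j + 1) (by omega)).2 (by omega)
      have h11 := passProb_le_one (S := S) (T := T) (u := u) (v := v) t (i + 1) (j + 1)
      linarith [hself.1]
    · have h11 := hall (i + 1) (j + 1) (by omega) (by omega) (by omega) (by omega) (by omega)
      by_cases h3 : S i = T j
      · rw [passProb_succ_match t h1 h2 h3]; linarith [hself.1]
      · rw [passProb_succ_mismatch t h1 h2 h3]
        have h10 := hall (i + 1) j (by omega) (by omega) (by omega) (by omega) (by omega)
        have h01 := hall i (j + 1) (by omega) (by omega) (by omega) (by omega) (by omega)
        linarith [hself.1]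

/-- A walk passes a match that is not on a given greedy optimal path with probability at most
`1 - Ω(1 / K²)`. -/
theorem passProb_le_of_off_path {S T : ℕ → Bool} {n K N : ℕ} {a b C : ℕ → ℕ}
    (h : OptimalPath S T n K N a b C) (hK : 1 ≤ K) {u v : ℕ} (hu : u < n) (hv : v < n)
    (huv : S u = T v) (hoff : ∀ l ≤ N, ¬ (a l = u ∧ b l = v)) (t : ℕ) :
    passProb S T u v t 0 0 ≤ 1 - 1 / (288 * (K : ℝ) ^ 2) := by
  have hK' : (1 : ℝ) ≤ (K : ℝ) ^ 2 := one_le_pow₀ (by exact_mod_cast hK)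
  have hsmall : 1 / (288 * (K : ℝ) ^ 2) ≤ 3 / 8 := by
    rw [div_le_iff₀ (by linarith)]
    linarith
  by_cases hf1 : u + 3 * K < v
  · linarith [passProb_le_of_far h hK hu hv hf1 t]
  by_cases hf2 : v + 3 * K < u
  · rw [← passProb_swap]
    linarith [passProb_le_of_far h.swap hK hv hu hf2 t]
  obtain ⟨r, i₀, j₀, hur, hvr, hw, hmax⟩ := exists_maximal_run u v huv
  have hrun : ∀ l ≤ N, ∀ k ≤ r, ¬ (a l = i₀ + k ∧ b l = j₀ + k) := by
    rintro l hl k hk ⟨h1, h2⟩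
    obtain ⟨l', hl', h3, h4⟩ := h.follows_run (by omega) (by omega) hw hl hk h1 h2
    exact hoff l' hl' ⟨by omega, by omega⟩
  have hex : ∃ l, i₀ ≤ a l ∧ j₀ ≤ b l := ⟨N, by rw [h.a_end]; omega, by rw [h.b_end]; omega⟩
  obtain ⟨l₀, hl₀def⟩ : ∃ l₀, l₀ = Nat.find hex := ⟨_, rfl⟩
  have hent : i₀ ≤ a l₀ ∧ j₀ ≤ b l₀ := by rw [hl₀def]; exact Nat.find_spec hex
  have hbefore : ∀ l < l₀, ¬ (i₀ ≤ a l ∧ j₀ ≤ b l) := by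
    intro l hl; rw [hl₀def] at hl; exact Nat.find_min hex hl
  have hl₀N : l₀ ≤ N := by
    by_contra hlt
    exact hbefore N (by omega) ⟨by rw [h.a_end]; omega, by rw [h.b_end]; omega⟩
  have hbox : ∀ t k k', k ≤ r → k' ≤ r → k ≠ k' →
      passProb S T u v t (i₀ + k) (j₀ + k') ≤ 1 - 1 / (64 * (K : ℝ) ^ 2) := by
    intro t k k' hk hk' hne
    -- Equality would make the entry node (i₀,j₀), which is on the run. Otherwise starts on the far
    -- side of the diagonal are reflected to the side of the path.
    rcases lt_trichotomy (b l₀ + i₀) (a l₀ + j₀) with hs | hs | hs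
    · have key := fun k k' => passProb_le_beside_run h hK hu hv hur hvr hw (by omega) hrun hl₀N
        hent hbefore hs t (k := k) (k' := k')
      rcases lt_or_gt_of_ne hne with h1 | h1
      · rw [passProb_transpose hur hvr hw]
        exact key k' k hk' h1
      · exact key k k' hk h1
    · exfalso
      rcases Nat.eq_zero_or_pos l₀ with h0 | h0
      · rw [h0, h.a_zero, h.b_zero] at hent
        exact hrun 0 (by omega) 0 (by omega) ⟨by rw [h.a_zero]; omega, by rw [h.b_zero]; omega⟩
      · have h1 := hbefore (l₀ - 1) (by omega)
        have h2 := h.step_le (l₀ - 1) (by omega)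
        rw [Nat.sub_add_cancel h0] at h2
        exact hrun l₀ hl₀N 0 (by omega) ⟨by omega, by omega⟩
    · have key := fun k k' => passProb_le_beside_run h.swap hK hv hu hvr hur
        (fun k hk => (hw k hk).symm) (by omega)
        (fun l hl k hk hh => hrun l hl k hk ⟨hh.2, hh.1⟩) hl₀N ⟨hent.2, hent.1⟩
        (fun l hl hh => hbefore l hl ⟨hh.2, hh.1⟩) hs t (k := k) (k' := k')
      rcases lt_or_gt_of_ne hne with h1 | h1
      · rw [← passProb_swap]
        exact key k' k hk' h1
      · rw [passProb_transpose hur hvr hw, ← passProb_swap]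
        exact key k k' hk h1
  have hout : 0 < i₀ ∨ 0 < j₀ := by
    by_contra h0
    exact hrun 0 (by omega) 0 (by omega) ⟨by rw [h.a_zero]; omega, by rw [h.b_zero]; omega⟩
  have hη1 : 1 / (64 * (K : ℝ) ^ 2) ≤ 1 := by
    rw [div_le_iff₀ (by linarith)]
    linarith
  have := passProb_le_of_run hur hvr hmax (by positivity) hη1 hbox t hout
  have e : 2 / 9 * (1 / (64 * (K : ℝ) ^ 2)) = 1 / (288 * (K : ℝ) ^ 2) := by
    field_simp
    norm_num
  rwa [e] at this

/-! ### Edit sequences and alignments have the same minimal cost -/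

/-- Alignments of two lists with the given number of edit operations, built from the front. -/
inductive ListAlign : List Bool → List Bool → ℕ → Prop
  | nil : ListAlign [] [] 0
  | keep {x y : List Bool} {k : ℕ} (a : Bool) (h : ListAlign x y k) : ListAlign (a :: x) (a :: y) k
  | subst {x y : List Bool} {k : ℕ} (a b : Bool) (h : ListAlign x y k) :
      ListAlign (a :: x) (b :: y) (k + 1)
  | delete {x y : List Bool} {k : ℕ} (a : Bool) (h : ListAlign x y k) :
      ListAlign (a :: x) y (k + 1)
  | ins {x y : List Bool} {k : ℕ} (b : Bool) (h : ListAlign x y k) : ListAlign x (b :: y) (k + 1)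

namespace ListAlign

lemma refl (x : List Bool) : ListAlign x x 0 := by
  induction x with
  | nil => exact nil
  | cons a x ih => exact ih.keep a

/-- A keep or substitution that produced the removed character becomes a deletion of its partner; an
insertion is dropped. -/
lemma delete_head {x y : List Bool} {k : ℕ} (h : ListAlign x y k) {c : Bool} {b : List Bool}
    (hy : y = c :: b) : ∃ k' ≤ k + 1, ListAlign x b k' := by
  induction h with
  | nil => simp at hy
  | keep a h _ =>
    obtain ⟨-, rfl⟩ := List.cons.inj hy
    exact ⟨_, le_rfl, h.delete a⟩
  | subst a _ h _ =>
    obtain ⟨-, rfl⟩ := List.cons.inj hy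
    exact ⟨_, Nat.le_succ _, h.delete a⟩
  | delete a _ ih =>
    obtain ⟨k', hk, h'⟩ := ih hy
    exact ⟨k' + 1, by omega, h'.delete a⟩
  | ins _ h _ =>
    obtain ⟨-, rfl⟩ := List.cons.inj hy
    exact ⟨_, by omega, h⟩

lemma subst_head {x y : List Bool} {k : ℕ} (h : ListAlign x y k) {c : Bool} {b : List Bool}
    (hy : y = c :: b) (c' : Bool) : ∃ k' ≤ k + 1, ListAlign x (c' :: b) k' := by
  induction h with
  | nil => simp at hy
  | keep a h _ =>
    obtain ⟨-, rfl⟩ := List.cons.inj hy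
    exact ⟨_, le_rfl, h.subst a c'⟩
  | subst a _ h _ =>
    obtain ⟨-, rfl⟩ := List.cons.inj hy
    exact ⟨_, Nat.le_succ _, h.subst a c'⟩
  | delete a _ ih =>
    obtain ⟨k', hk, h'⟩ := ih hy
    exact ⟨k' + 1, by omega, h'.delete a⟩
  | ins _ h _ =>
    obtain ⟨-, rfl⟩ := List.cons.inj hy
    exact ⟨_, Nat.le_succ _, h.ins c'⟩

/-- Operations producing the untouched prefix `a` are copied, which reduces an arbitrary edit to one
at the front. -/
lemma append_left {b b' : List Bool}
    (hb : ∀ x k, ListAlign x b k → ∃ k' ≤ k + 1, ListAlign x b' k') (a : List Bool)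
    {x y : List Bool} {k : ℕ} (h : ListAlign x y k) (hy : y = a ++ b) :
    ∃ k' ≤ k + 1, ListAlign x (a ++ b') k' := by
  induction a generalizing x y k with
  | nil => subst hy; exact hb x k h
  | cons c a iha =>
    induction h with
    | nil => simp at hy
    | keep d h _ =>
      obtain ⟨rfl, h2⟩ := List.cons.inj hy
      obtain ⟨k', hk, h'⟩ := iha h h2
      exact ⟨k', hk, h'.keep d⟩
    | subst d _ h _ =>
      obtain ⟨rfl, h2⟩ := List.cons.inj hy
      obtain ⟨k', hk, h'⟩ := iha h h2
      exact ⟨k' + 1, by omega, h'.subst d _⟩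
    | delete d _ ih =>
      obtain ⟨k', hk, h'⟩ := ih hy
      exact ⟨k' + 1, by omega, h'.delete d⟩
    | ins _ h _ =>
      obtain ⟨rfl, h2⟩ := List.cons.inj hy
      obtain ⟨k', hk, h'⟩ := iha h h2
      exact ⟨k' + 1, by omega, h'.ins _⟩

lemma editStep {x y z : List Bool} {k : ℕ} (h : ListAlign x y k) (e : EditStep y z) :
    ∃ k' ≤ k + 1, ListAlign x z k' := by
  cases e with
  | ins a b c => exact append_left (fun x k hx => ⟨k + 1, le_rfl, hx.ins c⟩) a h rfl
  | delete a b c => exact append_left (fun x k hx => hx.delete_head rfl) a h rfl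
  | subst a b c d => exact append_left (fun x k hx => hx.subst_head rfl d) a h rfl

lemma of_editsIn {x y : List Bool} {k : ℕ} (h : EditsIn k x y) : ∃ k' ≤ k, ListAlign x y k' := by
  induction h with
  | refl x => exact ⟨0, le_rfl, refl x⟩
  | step _ e ih =>
    obtain ⟨k', hk, h'⟩ := ih
    obtain ⟨k'', hk', h''⟩ := h'.editStep e
    exact ⟨k'', by omega, h''⟩

end ListAlign

section Alignments

variable {n : ℕ} {s t : Fin n → Bool}

lemma drop_ofFn_eq_cons {i : ℕ} {a : Bool} {x : List Bool} (h : a :: x = (List.ofFn s).drop i) :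
    ∃ hi : i < n, s ⟨i, hi⟩ = a ∧ x = (List.ofFn s).drop (i + 1) := by
  have hi : i < n := by
    by_contra hi
    rw [List.drop_eq_nil_of_le (by simpa using hi)] at h
    simp at h
  rw [List.drop_eq_getElem_cons (by simpa using hi)] at h
  obtain ⟨h1, h2⟩ := List.cons.inj h
  exact ⟨hi, by simpa using h1.symm, h2⟩

lemma drop_ofFn_eq_nil {i : ℕ} (hi : i ≤ n) (h : [] = (List.ofFn s).drop i) : i = n := by
  have := congrArg List.length h
  simp at this
  omega

lemma AlignsPrefix.extend_listAlign {x y : List Bool} {k : ℕ} (h : ListAlign x y k) {i j : ℕ}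
    (hi : i ≤ n) (hj : j ≤ n) (hx : x = (List.ofFn s).drop i) (hy : y = (List.ofFn t).drop j)
    {M : Finset (Fin n × Fin n)} {c : ℕ} (hM : AlignsPrefix s t i j M c) :
    ∃ M', AlignsPrefix s t n n M' (c + k) := by
  induction h generalizing i j M c with
  | nil =>
    have h1 := drop_ofFn_eq_nil hi hx
    have h2 := drop_ofFn_eq_nil hj hy
    subst h1
    rw [h2] at hM
    exact ⟨M, hM⟩
  | keep a _ ih =>
    obtain ⟨h1, h2, h3⟩ := drop_ofFn_eq_cons hx
    obtain ⟨h4, h5, h6⟩ := drop_ofFn_eq_cons hy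
    exact ih h1 h4 h3 h6 (AlignsPrefix.keep ⟨i, h1⟩ ⟨j, h4⟩ hM (h2.trans h5.symm))
  | subst a b _ ih =>
    obtain ⟨h1, h2, h3⟩ := drop_ofFn_eq_cons hx
    obtain ⟨h4, h5, h6⟩ := drop_ofFn_eq_cons hy
    have := ih h1 h4 h3 h6 (AlignsPrefix.subst ⟨i, h1⟩ ⟨j, h4⟩ hM)
    rwa [add_right_comm] at this
  | delete a _ ih =>
    obtain ⟨h1, h2, h3⟩ := drop_ofFn_eq_cons hx
    have := ih h1 hj h3 hy (AlignsPrefix.delete ⟨i, h1⟩ hM)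
    rwa [add_right_comm] at this
  | ins b _ ih =>
    obtain ⟨h4, h5, h6⟩ := drop_ofFn_eq_cons hy
    have := ih hi h4 hx h6 (AlignsPrefix.ins ⟨j, h4⟩ hM)
    rwa [add_right_comm] at this

lemma take_ofFn_succ (i : Fin n) :
    (List.ofFn s).take (i + 1) = (List.ofFn s).take i ++ [s i] := by
  rw [List.take_add_one]
  simp

/-- The arbitrary common tail `z` drives the induction: a kept character is moved into it. -/
lemma AlignsPrefix.editsIn {i j c : ℕ} {M : Finset (Fin n × Fin n)}
    (h : AlignsPrefix s t i j M c) (z : List Bool) :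
    EditsIn c ((List.ofFn s).take i ++ z) ((List.ofFn t).take j ++ z) := by
  induction h generalizing z with
  | nil => exact EditsIn.refl _
  | keep i j _ heq ih =>
    rw [take_ofFn_succ, take_ofFn_succ, List.append_assoc, List.append_assoc, ← heq]
    exact ih _
  | subst i j _ ih =>
    rw [take_ofFn_succ, take_ofFn_succ, List.append_assoc, List.append_assoc]
    exact (ih _).step (EditStep.subst _ z (s i) (t j))
  | delete i _ ih =>
    rw [take_ofFn_succ, List.append_assoc]
    exact (ih _).step (EditStep.delete _ z (s i))
  | ins j _ ih =>
    rw [take_ofFn_succ, List.append_assoc]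
    exact (ih _).step (EditStep.ins _ z (t j))

lemma editDist_le_of_alignsPrefix {c : ℕ} {M : Finset (Fin n × Fin n)}
    (h : AlignsPrefix s t n n M c) : editDist s t ≤ c := by
  have := h.editsIn []
  rw [List.append_nil, List.append_nil, List.take_of_length_le (by simp),
    List.take_of_length_le (by simp)] at this
  exact Nat.sInf_le this

lemma exists_alignsPrefix_of_editsIn {k : ℕ} (h : EditsIn k (List.ofFn s) (List.ofFn t)) :
    ∃ k' ≤ k, ∃ M, AlignsPrefix s t n n M k' := by
  obtain ⟨k', hk, h'⟩ := ListAlign.of_editsIn h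
  obtain ⟨M, hM⟩ := AlignsPrefix.extend_listAlign (s := s) (t := t) h' (Nat.zero_le _)
    (Nat.zero_le _) rfl rfl AlignsPrefix.nil
  exact ⟨k', hk, M, by simpa using hM⟩

lemma AlignsPrefix.exists_right {j : ℕ} (hj : j ≤ n) {i c : ℕ} {M : Finset (Fin n × Fin n)}
    (h : AlignsPrefix s t i 0 M c) : ∃ c', AlignsPrefix s t i j M c' := by
  induction j with
  | zero => exact ⟨c, h⟩
  | succ j ih =>
    obtain ⟨c', h'⟩ := ih (by omega)
    exact ⟨c' + 1, AlignsPrefix.ins ⟨j, hj⟩ h'⟩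

lemma AlignsPrefix.exists_trivial {i : ℕ} (hi : i ≤ n) : ∃ c, AlignsPrefix s t i 0 ∅ c := by
  induction i with
  | zero => exact ⟨0, AlignsPrefix.nil⟩
  | succ i ih =>
    obtain ⟨c', h'⟩ := ih (by omega)
    exact ⟨c' + 1, AlignsPrefix.delete ⟨i, hi⟩ h'⟩

lemma exists_isOptimalAlignment (s t : Fin n → Bool) : ∃ O, IsOptimalAlignment s t O := by
  obtain ⟨c, hc⟩ := AlignsPrefix.exists_trivial (s := s) (t := t) (le_refl n)
  obtain ⟨c', hc'⟩ := hc.exists_right (le_refl n)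
  have hne : {k : ℕ | EditsIn k (List.ofFn s) (List.ofFn t)}.Nonempty := by
    refine ⟨c', ?_⟩
    have := hc'.editsIn []
    rwa [List.append_nil, List.append_nil, List.take_of_length_le (by simp),
      List.take_of_length_le (by simp)] at this
  obtain ⟨k', hk, M, hM⟩ := exists_alignsPrefix_of_editsIn (Nat.sInf_mem hne)
  have : k' = editDist s t := le_antisymm hk (editDist_le_of_alignsPrefix hM)
  rw [this] at hM
  exact ⟨M, hM⟩

lemma exists_isGreedyAlignment (s t : Fin n → Bool) : ∃ O, IsGreedyAlignment s t O := by
  obtain ⟨O, hO, hmin⟩ := Set.exists_min_image {O | IsOptimalAlignment s t O} matchedIndexSum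
    (Set.toFinite _) (exists_isOptimalAlignment s t)
  exact ⟨O, hO, hmin⟩

/-! ### Cutting alignments and the greedy exchange -/

/-- Alignments of the suffixes of `s` and `t` from the positions `i` and `j`. -/
inductive AlignsSuffix {n : ℕ} (s t : Fin n → Bool) :
    ℕ → ℕ → Finset (Fin n × Fin n) → ℕ → Prop
  | nil : AlignsSuffix s t n n ∅ 0
  | keep {M : Finset (Fin n × Fin n)} {c : ℕ} (i j : Fin n)
      (h : AlignsSuffix s t (i + 1) (j + 1) M c) (heq : s i = t j) :
      AlignsSuffix s t i j (insert (i, j) M) c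
  | subst {M : Finset (Fin n × Fin n)} {c : ℕ} (i j : Fin n)
      (h : AlignsSuffix s t (i + 1) (j + 1) M c) : AlignsSuffix s t i j M (c + 1)
  | delete {M : Finset (Fin n × Fin n)} {c j : ℕ} (i : Fin n)
      (h : AlignsSuffix s t (i + 1) j M c) : AlignsSuffix s t i j M (c + 1)
  | ins {M : Finset (Fin n × Fin n)} {c i : ℕ} (j : Fin n)
      (h : AlignsSuffix s t i (j + 1) M c) : AlignsSuffix s t i j M (c + 1)

/-- Operations are transferred one at a time across the cut; together with `AlignsSuffix.append`
this lets the part after any node be replaced. -/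
lemma AlignsPrefix.suffix {i j c : ℕ} {M : Finset (Fin n × Fin n)}
    (h : AlignsPrefix s t i j M c) {M' : Finset (Fin n × Fin n)} {c' : ℕ}
    (h' : AlignsSuffix s t i j M' c') : AlignsSuffix s t 0 0 (M ∪ M') (c + c') := by
  induction h generalizing M' c' with
  | nil => simpa using h'
  | keep i j _ heq ih =>
    have := ih (AlignsSuffix.keep i j h' heq)
    rwa [Finset.union_insert, ← Finset.insert_union] at this
  | subst i j _ ih =>
    have := ih (AlignsSuffix.subst i j h')
    rwa [← add_assoc, add_right_comm] at this
  | delete i _ ih =>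
    have := ih (AlignsSuffix.delete i h')
    rwa [← add_assoc, add_right_comm] at this
  | ins j _ ih =>
    have := ih (AlignsSuffix.ins j h')
    rwa [← add_assoc, add_right_comm] at this

lemma AlignsSuffix.append {i j c' : ℕ} {M' : Finset (Fin n × Fin n)}
    (h' : AlignsSuffix s t i j M' c') {M : Finset (Fin n × Fin n)} {c : ℕ}
    (h : AlignsPrefix s t i j M c) : AlignsPrefix s t n n (M ∪ M') (c + c') := by
  induction h' generalizing M c with
  | nil => simpa using h
  | keep i j _ heq ih =>
    have := ih (AlignsPrefix.keep i j h heq)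
    rwa [Finset.insert_union, ← Finset.union_insert] at this
  | subst i j _ ih =>
    have := ih (AlignsPrefix.subst i j h)
    rwa [add_right_comm] at this
  | delete i _ ih =>
    have := ih (AlignsPrefix.delete i h)
    rwa [add_right_comm] at this
  | ins j _ ih =>
    have := ih (AlignsPrefix.ins j h)
    rwa [add_right_comm] at this

lemma AlignsPrefix.lt_of_mem {i j c : ℕ} {M : Finset (Fin n × Fin n)}
    (h : AlignsPrefix s t i j M c) : ∀ e ∈ M, e.1.val < i ∧ e.2.val < j := by
  induction h with
  | nil => simp
  | keep i j _ _ ih =>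
    intro e he
    rcases Finset.mem_insert.1 he with rfl | he
    · exact ⟨Nat.lt_succ_self _, Nat.lt_succ_self _⟩
    · have := ih e he; omega
  | subst i j _ ih => intro e he; have := ih e he; omega
  | delete i _ ih => intro e he; have := ih e he; omega
  | ins j _ ih => intro e he; have := ih e he; omega

lemma AlignsSuffix.le_of_mem {i j c : ℕ} {M : Finset (Fin n × Fin n)}
    (h : AlignsSuffix s t i j M c) : ∀ e ∈ M, i ≤ e.1.val ∧ j ≤ e.2.val := by
  induction h with
  | nil => simp
  | keep i j _ _ ih =>
    intro e he
    rcases Finset.mem_insert.1 he with rfl | he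
    · exact ⟨le_rfl, le_rfl⟩
    · have := ih e he; omega
  | subst i j _ ih => intro e he; have := ih e he; omega
  | delete i _ ih => intro e he; have := ih e he; omega
  | ins j _ ih => intro e he; have := ih e he; omega

/-- Removing the first character of the second suffix. -/
lemma AlignsSuffix.skip_right {i j' c : ℕ} {M : Finset (Fin n × Fin n)}
    (h : AlignsSuffix s t i j' M c) (j : Fin n) (hj : j' = j) :
    (∃ M' c', AlignsSuffix s t i (j + 1) M' c' ∧ c' ≤ c) ∨
      ∃ M' i', AlignsSuffix s t i (j + 1) M' (c + 1) ∧ i ≤ i'.val ∧ M = insert (i', j) M' := by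
  induction h with
  | nil => have := j.isLt; omega
  | keep i j₁ h _ _ =>
    obtain rfl := Fin.ext hj
    exact Or.inr ⟨_, i, h.delete i, le_rfl, rfl⟩
  | subst i j₁ h _ =>
    obtain rfl := Fin.ext hj
    exact Or.inl ⟨_, _, h.delete i, le_rfl⟩
  | delete i _ ih =>
    rcases ih hj with ⟨M', c', h1, h2⟩ | ⟨M', i', h1, h2, h3⟩
    · exact Or.inl ⟨M', c' + 1, h1.delete i, by omega⟩
    · exact Or.inr ⟨M', i', h1.delete i, by omega, h3⟩
  | ins j₁ h _ =>
    obtain rfl := Fin.ext hj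
    exact Or.inl ⟨_, _, h, Nat.le_succ _⟩

/-- Removing the first character of the first suffix. -/
lemma AlignsSuffix.skip_left {i' j c : ℕ} {M : Finset (Fin n × Fin n)}
    (h : AlignsSuffix s t i' j M c) (i : Fin n) (hi : i' = i) :
    (∃ M' c', AlignsSuffix s t (i + 1) j M' c' ∧ c' ≤ c) ∨
      ∃ M' j', AlignsSuffix s t (i + 1) j M' (c + 1) ∧ j ≤ j'.val ∧ M = insert (i, j') M' := by
  induction h with
  | nil => have := i.isLt; omega
  | keep i₁ j h _ _ =>
    obtain rfl := Fin.ext hi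
    exact Or.inr ⟨_, j, h.ins j, le_rfl, rfl⟩
  | subst i₁ j h _ =>
    obtain rfl := Fin.ext hi
    exact Or.inl ⟨_, _, h.ins j, le_rfl⟩
  | delete i₁ h _ =>
    obtain rfl := Fin.ext hi
    exact Or.inl ⟨_, _, h, Nat.le_succ _⟩
  | ins j _ ih =>
    rcases ih hi with ⟨M', c', h1, h2⟩ | ⟨M', j', h1, h2, h3⟩
    · exact Or.inl ⟨M', c' + 1, h1.ins j, by omega⟩
    · exact Or.inr ⟨M', j', h1.ins j, by omega, h3⟩

lemma matchedIndexSum_union_insert {i j i' j' c c' : ℕ} {M M' : Finset (Fin n × Fin n)}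
    (h : AlignsPrefix s t i j M c) (h' : AlignsSuffix s t i' j' M' c') (hi : i ≤ i')
    (e : Fin n × Fin n) (he : (i ≤ e.1.val ∨ j ≤ e.2.val)) (he' : e.1.val < i' ∨ e.2.val < j') :
    matchedIndexSum (M ∪ insert e M') =
      matchedIndexSum M + ((e.1.val + 1) + (e.2.val + 1)) + matchedIndexSum M' := by
  have h1 : e ∉ M' := fun hm => by have := h'.le_of_mem e hm; omega
  have h2 : Disjoint M (insert e M') := by
    rw [Finset.disjoint_left]
    intro f hf hf'
    have a1 := h.lt_of_mem f hf
    rcases Finset.mem_insert.1 hf' with rfl | hf'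
    · omega
    · have := h'.le_of_mem f hf'; omega
  unfold matchedIndexSum
  rw [Finset.sum_union h2, Finset.sum_insert h1, ← add_assoc]

/-- A greedy alignment admits no exchange in which an available match is kept. -/
lemma IsGreedyAlignment.exchange {O M : Finset (Fin n × Fin n)} {c c' : ℕ} {i j : Fin n}
    (hO : IsGreedyAlignment s t O) (h : AlignsPrefix s t i j M c) (heq : s i = t j)
    {M' : Finset (Fin n × Fin n)} (h' : AlignsSuffix s t (i + 1) (j + 1) M' c') :
    editDist s t ≤ c + c' ∧ (editDist s t = c + c' →
      matchedIndexSum O ≤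
        matchedIndexSum M + ((i.val + 1) + (j.val + 1)) + matchedIndexSum M') := by
  have hfull := (h'.keep i j heq).append h
  refine ⟨editDist_le_of_alignsPrefix hfull, fun he => ?_⟩
  have := hO.2 _ (show IsOptimalAlignment s t _ from he ▸ hfull)
  rwa [matchedIndexSum_union_insert h h' (Nat.le_succ _) (i, j) (Or.inl le_rfl)
    (Or.inl (Nat.lt_succ_self _))] at this

lemma IsGreedyAlignment.not_match_of_subst {O M M' : Finset (Fin n × Fin n)} {c c' : ℕ}
    {i j : Fin n} (hO : IsGreedyAlignment s t O) (h : AlignsPrefix s t i j M c)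
    (h' : AlignsSuffix s t (i + 1) (j + 1) M' c') (hc : c + (c' + 1) = editDist s t) :
    s i ≠ t j := by
  intro heq
  have := (hO.exchange h heq h').1
  omega

/-- If t[j] is edited later, matching it with s[i] now lowers the cost, against optimality. If it is
matched with a later character of `s`, rematching it with s[i] keeps the cost and lowers the index
sum, against greediness. -/
lemma IsGreedyAlignment.not_match_of_delete {O M M' : Finset (Fin n × Fin n)} {c c' : ℕ}
    {i j : Fin n} (hO : IsGreedyAlignment s t O) (h : AlignsPrefix s t i j M c)
    (h' : AlignsSuffix s t (i + 1) j M' c') (hM : M ∪ M' = O)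
    (hc : c + (c' + 1) = editDist s t) : s i ≠ t j := by
  intro heq
  rcases h'.skip_right j rfl with ⟨M₁, c₁, h1, h2⟩ | ⟨M₁, i₁, h1, h2, rfl⟩
  · have := (hO.exchange h heq h1).1
    omega
  · have h3 := (hO.exchange h heq h1).2 (by omega)
    rw [← hM, matchedIndexSum_union_insert h h1 (Nat.le_succ _) (i₁, j) (Or.inr le_rfl)
      (Or.inr (Nat.lt_succ_self _))] at h3
    simp only at h3
    omega

lemma IsGreedyAlignment.not_match_of_ins {O M M' : Finset (Fin n × Fin n)} {c c' : ℕ}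
    {i j : Fin n} (hO : IsGreedyAlignment s t O) (h : AlignsPrefix s t i j M c)
    (h' : AlignsSuffix s t i (j + 1) M' c') (hM : M ∪ M' = O)
    (hc : c + (c' + 1) = editDist s t) : s i ≠ t j := by
  intro heq
  rcases h'.skip_left i rfl with ⟨M₁, c₁, h1, h2⟩ | ⟨M₁, j₁, h1, h2, rfl⟩
  · have := (hO.exchange h heq h1).1
    omega
  · have h3 := (hO.exchange h heq h1).2 (by omega)
    rw [← hM, matchedIndexSum_union_insert h h1 (Nat.le_succ _) (i, j₁) (Or.inl le_rfl)
      (Or.inl (Nat.lt_succ_self _))] at h3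
    simp only at h3
    omega

/-! ### The lattice path of a greedy alignment -/

/-- A step of the lattice path of the greedy alignment `O`. -/
def IsGreedyStep (s t : Fin n → Bool) (O : Finset (Fin n × Fin n)) (i j c i' j' c' : ℕ) : Prop :=
  ((i' = i + 1 ∧ j' = j + 1 ∧ c' = c ∧ extendString s i = extendString t j) ∨
    (i' = i + 1 ∧ j' = j + 1 ∧ c' = c + 1) ∨
    (i' = i + 1 ∧ j' = j ∧ c' = c + 1) ∨ (i' = i ∧ j' = j + 1 ∧ c' = c + 1)) ∧
  ∀ u v : Fin n, u.val = i → v.val = j → s u = t v →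
    (i' = i + 1 ∧ j' = j + 1 ∧ c' = c) ∧ (u, v) ∈ O

/-- The node `(i, j)` lies on an optimal alignment that has cost `c` up to this node. -/
def IsOptimalNode (s t : Fin n → Bool) (i j c : ℕ) : Prop :=
  (∃ M, AlignsPrefix s t i j M c) ∧ ∃ M c', AlignsSuffix s t i j M c' ∧ c + c' = editDist s t

/-- The rest, from `(i, j)` on, of the lattice path of the greedy alignment `O`. -/
def HasGreedyPath (s t : Fin n → Bool) (O : Finset (Fin n × Fin n)) (i j c : ℕ) : Prop :=
  ∃ (N : ℕ) (a b C : ℕ → ℕ), a 0 = i ∧ b 0 = j ∧ C 0 = c ∧ a N = n ∧ b N = n ∧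
    C N = editDist s t ∧
    (∀ l < N, IsGreedyStep s t O (a l) (b l) (C l) (a (l + 1)) (b (l + 1)) (C (l + 1))) ∧
    ∀ l ≤ N, IsOptimalNode s t (a l) (b l) (C l)

lemma HasGreedyPath.cons {O : Finset (Fin n × Fin n)} {i j c i' j' c' : ℕ}
    (h : HasGreedyPath s t O i' j' c') (hs : IsGreedyStep s t O i j c i' j' c')
    (hn : IsOptimalNode s t i j c) : HasGreedyPath s t O i j c := by
  obtain ⟨N, a, b, C, h1, h2, h3, h4, h5, h6, h7, h8⟩ := h
  refine ⟨N + 1, fun l => Nat.casesOn l i a, fun l => Nat.casesOn l j b,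
    fun l => Nat.casesOn l c C, rfl, rfl, rfl, h4, h5, h6, ?_, ?_⟩
  · intro l hl
    cases l with
    | zero => simp only [h1, h2, h3]; exact hs
    | succ l => exact h7 l (by omega)
  · intro l hl
    cases l with
    | zero => exact hn
    | succ l => exact h8 l (by omega)

lemma extendString_fin (s : Fin n → Bool) (i : Fin n) : extendString s i = s i := by
  simp [extendString]

/-- The prefix part `M₁` is carried along so that every node splits `O` in two, the form the
exchange lemmas require. -/
lemma AlignsSuffix.hasGreedyPath {O : Finset (Fin n × Fin n)} (hO : IsGreedyAlignment s t O)
    {i j c : ℕ} {M : Finset (Fin n × Fin n)} (h : AlignsSuffix s t i j M c)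
    {M₁ : Finset (Fin n × Fin n)} {c₁ : ℕ} (h₁ : AlignsPrefix s t i j M₁ c₁) (hM : M₁ ∪ M = O)
    (hc : c₁ + c = editDist s t) : HasGreedyPath s t O i j c₁ := by
  induction h generalizing M₁ c₁ with
  | nil =>
    refine ⟨0, fun _ => n, fun _ => n, fun _ => c₁, rfl, rfl, rfl, rfl, rfl, hc, by simp, ?_⟩
    intro _ _
    exact ⟨⟨_, h₁⟩, _, _, AlignsSuffix.nil, hc⟩
  | keep i j h heq ih =>
    have hp := ih (AlignsPrefix.keep i j h₁ heq)
      (by rw [← hM, Finset.insert_union, ← Finset.union_insert]) hc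
    refine hp.cons ⟨Or.inl ⟨rfl, rfl, rfl, ?_⟩, ?_⟩ ⟨⟨_, h₁⟩, _, _, h.keep i j heq, hc⟩
    · rw [extendString_fin, extendString_fin, heq]
    · intro u v hu hv _
      obtain rfl := Fin.ext hu
      obtain rfl := Fin.ext hv
      refine ⟨⟨rfl, rfl, rfl⟩, ?_⟩
      rw [← hM]
      simp
  | subst i j h ih =>
    have hp := ih (AlignsPrefix.subst i j h₁) hM (by omega)
    refine hp.cons ⟨Or.inr (Or.inl ⟨rfl, rfl, rfl⟩), ?_⟩ ⟨⟨_, h₁⟩, _, _, h.subst i j, hc⟩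
    intro u v hu hv heq
    obtain rfl := Fin.ext hu
    obtain rfl := Fin.ext hv
    exact absurd heq (hO.not_match_of_subst h₁ h hc)
  | delete i h ih =>
    have hp := ih (AlignsPrefix.delete i h₁) hM (by omega)
    refine hp.cons ⟨Or.inr (Or.inr (Or.inl ⟨rfl, rfl, rfl⟩)), ?_⟩
      ⟨⟨_, h₁⟩, _, _, h.delete i, hc⟩
    intro u v hu hv heq
    obtain rfl := Fin.ext hu
    subst hv
    exact absurd heq (hO.not_match_of_delete h₁ h hM hc)
  | ins j h ih =>
    have hp := ih (AlignsPrefix.ins j h₁) hM (by omega)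
    refine hp.cons ⟨Or.inr (Or.inr (Or.inr ⟨rfl, rfl, rfl⟩)), ?_⟩
      ⟨⟨_, h₁⟩, _, _, h.ins j, hc⟩
    intro u v hu hv heq
    obtain rfl := Fin.ext hv
    subst hu
    exact absurd heq (hO.not_match_of_ins h₁ h hM hc)

lemma AlignsPrefix.extend_segment {i j c : ℕ} {M : Finset (Fin n × Fin n)}
    (h : AlignsPrefix s t i j M c) {i' j' d : ℕ}
    (hs : AlignSegment (extendString s) (extendString t) i j i' j' d) (hi : i' ≤ n)
    (hj : j' ≤ n) : ∃ M', AlignsPrefix s t i' j' M' (c + d) := by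
  induction hs with
  | nil => exact ⟨M, h⟩
  | @keep i' j' d _ heq ih =>
    obtain ⟨M', hM'⟩ := ih (by omega) (by omega)
    refine ⟨_, AlignsPrefix.keep ⟨i', hi⟩ ⟨j', hj⟩ hM' ?_⟩
    rwa [← extendString_fin s, ← extendString_fin t]
  | @subst i' j' d _ ih =>
    obtain ⟨M', hM'⟩ := ih (by omega) (by omega)
    exact ⟨_, AlignsPrefix.subst ⟨i', hi⟩ ⟨j', hj⟩ hM'⟩
  | @delete i' j' d _ ih =>
    obtain ⟨M', hM'⟩ := ih (by omega) (by omega)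
    exact ⟨_, AlignsPrefix.delete ⟨i', hi⟩ hM'⟩
  | @ins i' j' d _ ih =>
    obtain ⟨M', hM'⟩ := ih (by omega) (by omega)
    exact ⟨_, AlignsPrefix.ins ⟨j', hj⟩ hM'⟩

/-- Optimality between two nodes follows by splicing: the prefix up to the first, a competing
segment, and the suffix from the second form an alignment, which costs at least the edit distance.
-/
lemma IsGreedyAlignment.exists_optimalPath {O : Finset (Fin n × Fin n)}
    (hO : IsGreedyAlignment s t O) {K : ℕ} (hK : editDist s t ≤ K) :
    ∃ (N : ℕ) (a b C : ℕ → ℕ),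
      OptimalPath (extendString s) (extendString t) n K N a b C ∧
      ∀ l ≤ N, ∀ u v : Fin n, a l = u → b l = v → s u = t v → (u, v) ∈ O := by
  have hsuf := hO.1.suffix AlignsSuffix.nil
  rw [Finset.union_empty, add_zero] at hsuf
  obtain ⟨N, a, b, C, h1, h2, h3, h4, h5, h6, h7, h8⟩ :=
    hsuf.hasGreedyPath hO AlignsPrefix.nil (Finset.empty_union _) (zero_add _)
  have hmono : ∀ l l', l ≤ l' → l' ≤ N → a l ≤ a l' ∧ b l ≤ b l' := by
    intro l l' h
    induction l', h using Nat.le_induction with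
    | base => intro _; exact ⟨le_rfl, le_rfl⟩
    | succ l' _ ih =>
      intro hl'
      have e1 := ih (by omega)
      have e2 := (h7 l' (by omega)).1
      omega
  refine ⟨N, a, b, C, ⟨h1, h2, h3, h4, h5, h6.trans_le hK, fun l hl => (h7 l hl).1, ?_, ?_⟩, ?_⟩
  · intro l hl ha hb heq
    refine ((h7 l hl).2 ⟨a l, ha⟩ ⟨b l, hb⟩ rfl rfl ?_).1
    rwa [← extendString_fin s, ← extendString_fin t]
  · intro l₁ l₂ hl hl₂ c hc
    obtain ⟨⟨M, hM⟩, -⟩ := h8 l₁ (hl.trans hl₂)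
    obtain ⟨-, M₂, c₂, hM₂, hc₂⟩ := h8 l₂ hl₂
    have hle := hmono l₂ N hl₂ le_rfl
    obtain ⟨M', hM'⟩ := hM.extend_segment hc (by omega) (by omega)
    have := editDist_le_of_alignsPrefix (hM₂.append hM')
    omega
  · intro l hl u v hu hv heq
    rcases hl.lt_or_eq with h | rfl
    · exact ((h7 l h).2 u v hu.symm hv.symm heq).2
    · have := u.isLt; omega

end Alignments

/-! ### Independent walks and the union bound -/

section Walks

open MeasureTheory

instance isProbabilityMeasure_walksLaw (n ρ : ℕ) : IsProbabilityMeasure (walksLaw n ρ) := by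
  unfold walksLaw
  infer_instance

/-- The probability that a single walk passes `(u, v)` is at most `passProb`. -/
lemma walk_real_passes_le {n : ℕ} (s t : Fin n → Bool) (u v : Fin n) :
    ((PMF.uniformOfFintype (WalkBits n)).toMeasure).real {r | WalkPasses s t r u v} ≤
      passProb (extendString s) (extendString t) u v (3 * n) 0 0 := by
  classical
  have hcard : (0 : ℝ) < Fintype.card (WalkBits n) := by
    exact_mod_cast Fintype.card_pos
  rw [Measure.real, PMF.toMeasure_uniformOfFintype_apply _ (Set.toFinite _).measurableSet,
    ENNReal.toReal_div, ENNReal.toReal_natCast, ENNReal.toReal_natCast,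
    div_le_iff₀ hcard]
  refine le_trans (le_of_eq ?_) ((card_walkPasses_le s t u v).trans_eq (mul_comm _ _))
  rw [← Set.toFinset_card]
  congr 2
  ext r
  simp

/-- All walks pass a given pair independently of each other. -/
lemma walksLaw_real_forall {n ρ : ℕ} (A : Set (WalkBits n)) :
    (walksLaw n ρ).real {R | ∀ a, R a ∈ A} =
      ((PMF.uniformOfFintype (WalkBits n)).toMeasure).real A ^ ρ := by
  have : {R : Fin ρ → WalkBits n | ∀ a, R a ∈ A} = Set.univ.pi fun _ => A := by
    ext R; simp
  rw [this, Measure.real, walksLaw, Measure.pi_pi, Finset.prod_const, Finset.card_univ,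
    Fintype.card_fin, ENNReal.toReal_pow]
  rfl

/-- With 1 - x ≤ exp(-x) and log n ≤ log₂ n, the constant 1152 = 4 · 288 yields the exponent -4 log
n. -/
lemma pow_numWalks_le {c : ℝ} (hc : 1152 ≤ c) {n K : ℕ} (hn : 1 ≤ n) (hK : 1 ≤ K) {q : ℝ}
    (hq0 : 0 ≤ q) (hq : q ≤ 1 - 1 / (288 * (K : ℝ) ^ 2)) :
    q ^ numWalks c K n ≤ 1 / (n : ℝ) ^ 4 := by
  have hn' : (1 : ℝ) ≤ n := by exact_mod_cast hn
  have hK' : (1 : ℝ) ≤ (K : ℝ) ^ 2 := one_le_pow₀ (by exact_mod_cast hK)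
  have hlog : 0 ≤ Real.log n := Real.log_nonneg hn'
  have hlog2 : Real.log n ≤ Real.logb 2 n := by
    rw [Real.logb, le_div_iff₀ (Real.log_pos (by norm_num))]
    have : Real.log 2 ≤ 1 := by linarith [Real.log_two_lt_d9]
    nlinarith
  have hρ : 1152 * (K : ℝ) ^ 2 * Real.log n ≤ numWalks c K n := by
    refine le_trans ?_ (Nat.le_ceil _)
    gcongr
  have hq' : q ≤ Real.exp (-(1 / (288 * (K : ℝ) ^ 2))) := by
    have := Real.add_one_le_exp (-(1 / (288 * (K : ℝ) ^ 2)))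
    linarith
  calc q ^ numWalks c K n ≤ Real.exp (-(1 / (288 * (K : ℝ) ^ 2))) ^ numWalks c K n := by gcongr
    _ = Real.exp (-(numWalks c K n / (288 * (K : ℝ) ^ 2))) := by
      rw [← Real.exp_nat_mul]
      congr 1
      ring
    _ ≤ Real.exp (-(4 * Real.log n)) := by
      rw [Real.exp_le_exp, neg_le_neg_iff, le_div_iff₀ (by linarith)]
      linarith
    _ = 1 / (n : ℝ) ^ 4 := by
      rw [Real.exp_neg, one_div, mul_comm, Real.exp_mul, Real.exp_log (by linarith)]
      norm_cast

/-- Only matches outside `O` can spoil the event, and these are off the path because `O` contains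
every match the path visits. There are at most n² of them, each passed by all walks with probability
at most n⁻⁴. -/
lemma greedy_passes_anchors {c : ℝ} (hc : 1152 ≤ c) {n K : ℕ} (hn : 1 ≤ n) (hK : 1 ≤ K)
    {s t : Fin n → Bool} (hed : editDist s t ≤ K) {O : Finset (Fin n × Fin n)}
    (hO : IsGreedyAlignment s t O) :
    1 - 1 / (n : ℝ) ^ 2 ≤ (walksLaw n (numWalks c K n)).real
      {R | ∀ u v : Fin n, IsAnchor s t R u v → (u, v) ∈ O} := by
  classical
  obtain ⟨N, a, b, C, hpath, hmem⟩ := hO.exists_optimalPath hed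
  have hn' : (0 : ℝ) < n := by exact_mod_cast hn
  let A (e : Fin n × Fin n) : Set (Fin (numWalks c K n) → WalkBits n) :=
    {R | ∀ i, R i ∈ {r | WalkPasses s t r e.1 e.2}}
  let B : Finset (Fin n × Fin n) := Finset.univ.filter fun e => s e.1 = t e.2 ∧ e ∉ O
  have hA : ∀ e ∈ B, (walksLaw n (numWalks c K n)).real (A e) ≤ 1 / (n : ℝ) ^ 4 := by
    rintro ⟨u, v⟩ he
    obtain ⟨-, h1, h2⟩ := Finset.mem_filter.1 he
    rw [walksLaw_real_forall]
    refine pow_numWalks_le hc hn hK measureReal_nonneg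
      ((walk_real_passes_le s t u v).trans ?_)
    refine passProb_le_of_off_path hpath hK u.isLt v.isLt ?_ ?_ _
    · rw [extendString_fin, extendString_fin]; exact h1
    · rintro l hl ⟨h3, h4⟩
      exact h2 (hmem l hl u v h3 h4 h1)
  have hcard : (B.card : ℝ) ≤ (n : ℝ) ^ 2 := by
    have : B.card ≤ n ^ 2 := by
      refine (Finset.card_le_univ B).trans (le_of_eq ?_)
      simp [sq]
    exact_mod_cast this
  have hbad : (walksLaw n (numWalks c K n)).real (⋃ e ∈ B, A e) ≤ 1 / (n : ℝ) ^ 2 := by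
    calc _ ≤ ∑ e ∈ B, (walksLaw n (numWalks c K n)).real (A e) :=
          measureReal_biUnion_finset_le _ _
      _ ≤ B.card • (1 / (n : ℝ) ^ 4) := Finset.sum_le_card_nsmul _ _ _ hA
      _ ≤ (n : ℝ) ^ 2 * (1 / (n : ℝ) ^ 4) := by rw [nsmul_eq_mul]; gcongr
      _ = 1 / (n : ℝ) ^ 2 := by field_simp
  have hcompl : (⋃ e ∈ B, A e)ᶜ ⊆ {R | ∀ u v : Fin n, IsAnchor s t R u v → (u, v) ∈ O} := by
    intro R hR u v hanchor
    by_contra hno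
    refine hR (Set.mem_biUnion (x := (u, v)) ?_ hanchor.2)
    simp only [B, Finset.coe_filter, Finset.mem_univ, true_and, Set.mem_ofPred_eq]
    exact ⟨hanchor.1, hno⟩
  refine le_trans ?_ (measureReal_mono hcompl)
  rw [probReal_compl_eq_one_sub (Set.toFinite _).measurableSet]
  linarith

end Walks

theorem mainTheorem5 :
    ∃ c₀ : ℝ, 0 < c₀ ∧ ∀ c : ℝ, c₀ ≤ c → ∀ n K : ℕ, 1 ≤ n → 1 ≤ K →
      ∀ s t : Fin n → Bool, editDist s t ≤ K →
        (1 - 1 / (n : ℝ) ^ 2 ≤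
          (walksLaw n (numWalks c K n)).real
            {R | ∃ O : Finset (Fin n × Fin n), IsOptimalAlignment s t O ∧
              ∀ u v : Fin n, IsAnchor s t R u v → (u, v) ∈ O}) ∧
        (∃ O : Finset (Fin n × Fin n), IsGreedyAlignment s t O) ∧
        (∀ O : Finset (Fin n × Fin n), IsGreedyAlignment s t O →
          1 - 1 / (n : ℝ) ^ 2 ≤
            (walksLaw n (numWalks c K n)).real
              {R | ∀ u v : Fin n, IsAnchor s t R u v → (u, v) ∈ O}) := by
  refine ⟨1152, by norm_num, fun c hc n K hn hK s t hed => ?_⟩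
  obtain ⟨O, hO⟩ := exists_isGreedyAlignment s t
  refine ⟨?_, ⟨O, hO⟩, fun O' hO' => greedy_passes_anchors hc hn hK hed hO'⟩
  exact (greedy_passes_anchors hc hn hK hed hO).trans
    (MeasureTheory.measureReal_mono fun R hR => ⟨O, hO.1, hR⟩)
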